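/- **Setting.** Let $\mathcal M=(S,s_0,A,\delta)$ be a finite MDP and $\Phi=(F,r)$ a weighted reachability objective with $F\subseteq S$ and $r:F\to\mathbb Q$; the value $\Phi(\rho)$ of a path is the reward of the first visited state of $F$, and $0$ if $F$ is never visited. Target states are assumed to be absorbing and to have non-zero reward. Let $o_1<\dots<o_k$ be the elements of $\{r(s): s\in F\}\cup\{0\}$. Let $u:\mathbb R\to\mathbb R$ be increasing and continuous, and let $w^+,w^-:[0,1]\to[0,1]$ be increasing and Lipschitz continuous with Lipschitz constants $L^+,L^-$. For $p\in[0,1]^k$ with $\sum_i p_i\le 1$ put $\mathsf{cpt}(o,p)=\sum_i u(o_i)\pi_i$, where $\pi_i=w^+(\sum_{m\ge i}p_m)-w^+(\sum_{m>i}p_m)$ if $o_i>0$, $\pi_i=w^-(\sum_{m\le i}p_m)-w^-(\sum_{m<i}p_m)$ if $o_i<0$, and $\pi_i=0$ if $o_i=0$. The CPT-value is $$\mathsf{CPT\text{-}val}(\mathcal M,\Phi)=\sup_\sigma\Big(\sum_{o_i>0}u(o_i)\big(w^+(\mathbb P^\sigma[\Phi\ge o_i])-w^+(\mathbb P^\sigma[\Phi>o_i])\big)+\sum_{o_i<0}u(o_i)\big(w^-(\mathbb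 P^\sigma[\Phi\le o_i])-w^-(\mathbb P^\sigma[\Phi<o_i])\big)\Big),$$ over all history-dependent randomized strategies $\sigma$. Let $L_{\mathsf{cpt}}=\max_i|u(o_i)|\cdot\max(L^+,L^-)\cdot(2k^2+k)$. **Algorithm 2** with precision $\varepsilon>0$: 1. *Stopping transformation.* Let $\widehat{\mathcal M}$ be the MDP obtained from $\mathcal M$ by adding an absorbing sink $z$ and replacing every maximal end component $(T,B)$ with $T\cap F=\emptyset$ by one state, whose actions are those of the states of $T$ that are not in $B$, and a new action $\mathsf{stay}$ leading to $z$. 2. *Query.* Let $\mathcal Q=(F_1,\dots,F_k)$ with $F_i=\{s\in F: r(s)=o_i\}$ if $o_i\neq0$, and $F_i=\{z\}$ if $o_i=0$. A point $p\in\mathbb R^k$ is achievable if some strategy $\sigma$ of $\widehat{\mathcal M}$ satisfies $p_i\le\mathbb P^\sigma[\lozenge F_i]$ for all $i$; the Pareto frontier is the set of the achievable points that are maximal in the componentwise order. 3. *Approximation.* Choose a finite set of non-negative achievable points whose convex hull $\mathcal P$ is an $\varepsilon$-approximation of the Pareto frontier: every point of $\mathcal P$ is within Euclidean distance $\varepsilon$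 of a point of the frontier, and vice versa. 4. *Grid optimization.* Cover $[0,1]^k$ by axis-parallel closed hypercubes of a grid with side length $\varepsilon/(L_{\mathsf{cpt}}\sqrt k)$ (by the single cube $[0,1]^k$ if $L_{\mathsf{cpt}}=0$), select in each hypercube that meets $\mathcal P$ one vector of the intersection, and return the maximum $v$ of $\mathsf{cpt}(o,\cdot)$ over the selected vectors. **Lemma (Correctness and Error Estimation).** The supremum defining $\mathsf{CPT\text{-}val}(\mathcal M,\Phi)$ is finite, Algorithm 2 can always be carried out (a finite set as in step 3 exists and step 4 yields an output), and every output $v$ of Algorithm 2, whatever choices are made in steps 3 and 4, satisfies $$|\mathsf{CPT\text{-}val}(\mathcal M,\Phi)-v|\le\varepsilon\cdot(1+L_{\mathsf{cpt}}).$$ -/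

import Mathlib

open scoped NNReal ENNReal

namespace CPTMDP

noncomputable section

universe u v

/-! ### Markov decision processes, strategies and the induced measure on paths -/

/-- A Markov decision process with states `S` and actions `A`. The values of `δ` on unavailable
actions are irrelevant. (Finiteness of `S` and `A` is assumed where it is needed.) -/
structure MDP (S : Type u) (A : Type v) where
  /-- the initial state -/
  init : S
  /-- the actions available in a state -/
  avail : S → Set A
  avail_nonempty : ∀ s, (avail s).Nonempty
  /-- the transition function -/
  δ : S → A → PMF S

/-- One step of a path: a state together with the action that is chosen in it. -/
def Step (S : Type u) (A : Type v) : Type (max u v) := S × A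

instance (S : Type u) (A : Type v) : MeasurableSpace (Step S A) := ⊤

instance (S : Type u) (A : Type v) : DiscreteMeasurableSpace (Step S A) := ⟨fun _ => trivial⟩

instance (S : Type u) (A : Type v) [Finite S] [Finite A] : Finite (Step S A) :=
  inferInstanceAs (Finite (S × A))

/-- A history-dependent randomized strategy: after the history `s₀ a₀ … sₙ₋₁ aₙ₋₁` with current
state `s`, it yields a distribution over the actions available in `s`. -/
structure Strategy {S : Type u} {A : Type v} (M : MDP S A) where
  act : (n : ℕ) → (Fin n → Step S A) → S → PMF A
  act_avail : ∀ n h s, (act n h s).support ⊆ M.avail s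

section Paths

variable {S : Type u} {A : Type v} {M : MDP S A}

/-- Distribution of the first step: the initial state with an action chosen by the strategy. -/
def Strategy.first (σ : Strategy M) : PMF (Step S A) :=
  (σ.act 0 Fin.elim0 M.init).map fun a => (M.init, a)

/-- Distribution of step `n + 1` given the steps `0, …, n`: the next state is drawn from the
transition function, then an action is drawn from the strategy. -/
def Strategy.next (σ : Strategy M) (n : ℕ) (x : (Finset.Iic n) → Step S A) : PMF (Step S A) :=
  (M.δ (x ⟨n, Finset.mem_Iic.2 le_rfl⟩).1 (x ⟨n, Finset.mem_Iic.2 le_rfl⟩).2).bind fun s =>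
    (σ.act (n + 1) (fun i => x ⟨i, Finset.mem_Iic.2 (Nat.lt_succ_iff.1 i.2)⟩) s).map
      fun a => (s, a)

variable [Finite S] [Finite A]

/-- The one-step distributions as Markov kernels. -/
def Strategy.kernel (σ : Strategy M) (n : ℕ) :
    ProbabilityTheory.Kernel ((Finset.Iic n) → Step S A) (Step S A) :=
  ProbabilityTheory.Kernel.ofFunOfCountable fun x => (σ.next n x).toMeasure

instance (σ : Strategy M) (n : ℕ) : ProbabilityTheory.IsMarkovKernel (σ.kernel n) :=
  ⟨fun x => inferInstanceAs (MeasureTheory.IsProbabilityMeasure (σ.next n x).toMeasure)⟩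

/-- The probability measure on infinite paths `s₀ a₀ s₁ a₁ …` that the strategy `σ` induces. -/
def Strategy.pathMeasure (σ : Strategy M) : MeasureTheory.Measure (ℕ → Step S A) :=
  ProbabilityTheory.Kernel.trajMeasure (X := fun _ => Step S A) σ.first.toMeasure σ.kernel

/-- The probability of an event on paths, as a real number. -/
def Strategy.prob (σ : Strategy M) (E : Set (ℕ → Step S A)) : ℝ := σ.pathMeasure.real E

/-- The paths that visit the set of states `T`. -/
def reach (T : Set S) : Set (ℕ → Step S A) := {ρ | ∃ j, (ρ j).1 ∈ T}

end Paths

/-! ### Weighted reachability objectives -/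

/-- A weighted reachability objective: target states with their (rational) rewards.
The values of `reward` outside `target` are irrelevant. -/
structure WRObjective (S : Type u) where
  target : Set S
  reward : S → ℚ

section Objective

variable {S : Type u} {A : Type v}

open Classical in
/-- The value of a path: the reward of the first visited target state, and `0` if there is none. -/
def WRObjective.value (Φ : WRObjective S) (ρ : ℕ → Step S A) : ℝ :=
  if h : ∃ n, (ρ n).1 ∈ Φ.target then (Φ.reward (ρ (Nat.find h)).1 : ℝ) else 0

variable [Finite S]

/-- The set of outcomes: the rewards of the target states, and `0`. -/
def WRObjective.outc (Φ : WRObjective S) : Finset ℝ :=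
  (((Set.toFinite Φ.target).image fun s => (Φ.reward s : ℝ)).insert 0).toFinset

/-- The number `k` of outcomes. -/
def WRObjective.numOutc (Φ : WRObjective S) : ℕ := Φ.outc.card

/-- The increasingly ordered vector of outcomes. -/
def WRObjective.outcomes (Φ : WRObjective S) : Fin Φ.numOutc → ℝ := Φ.outc.orderEmbOfFin rfl

/-- The standing assumption that all target states are absorbing. -/
def WRObjective.Absorbing (Φ : WRObjective S) (M : MDP S A) : Prop :=
  ∀ s ∈ Φ.target, ∀ a ∈ M.avail s, M.δ s a = PMF.pure s

/-- The standing assumption that the rewards of target states are not `0`. -/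
def WRObjective.NonzeroRewards (Φ : WRObjective S) : Prop := ∀ s ∈ Φ.target, Φ.reward s ≠ 0

end Objective

/-! ### The CPT-function and the CPT-value -/

/-- The ingredients of a CPT-function: an increasing continuous utility function and two increasing
probability weighting functions from `[0, 1]` to `[0, 1]`. -/
structure CPTFunction where
  /-- utility -/
  u : ℝ → ℝ
  /-- weighting of the probabilities of gains -/
  wPlus : ℝ → ℝ
  /-- weighting of the probabilities of losses -/
  wMinus : ℝ → ℝ
  u_mono : Monotone u
  u_cont : Continuous u
  wPlus_mono : MonotoneOn wPlus (Set.Icc 0 1)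
  wMinus_mono : MonotoneOn wMinus (Set.Icc 0 1)
  wPlus_cont : ContinuousOn wPlus (Set.Icc 0 1)
  wMinus_cont : ContinuousOn wMinus (Set.Icc 0 1)
  wPlus_mapsTo : Set.MapsTo wPlus (Set.Icc 0 1) (Set.Icc 0 1)
  wMinus_mapsTo : Set.MapsTo wMinus (Set.Icc 0 1) (Set.Icc 0 1)

/-- Gain rank: the probability of strictly more than outcome `i`. -/
def grank {k : ℕ} (p : Fin k → ℝ) (i : Fin k) : ℝ := ∑ m ∈ Finset.Ioi i, p m

/-- Loss rank: the probability of strictly less than outcome `i`. -/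
def lrank {k : ℕ} (p : Fin k → ℝ) (i : Fin k) : ℝ := ∑ m ∈ Finset.Iio i, p m

/-- The decision weight of the `i`-th outcome of the prospect `(o, p)`. -/
def CPTFunction.decisionWeight (C : CPTFunction) {k : ℕ} (o p : Fin k → ℝ) (i : Fin k) : ℝ :=
  if 0 < o i then C.wPlus (p i + grank p i) - C.wPlus (grank p i)
  else if o i < 0 then C.wMinus (p i + lrank p i) - C.wMinus (lrank p i)
  else 0

/-- The CPT-function on the prospect `(o, p)`, with `o` ordered increasingly. -/
def CPTFunction.cpt (C : CPTFunction) {k : ℕ} (o p : Fin k → ℝ) : ℝ :=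
  ∑ i, C.u (o i) * C.decisionWeight o p i

/-- The Lipschitz constant `u* · max(L⁺, L⁻) · (2k² + k)` of the CPT-function, where
`u* = maxᵢ |u(oᵢ)|` and `L⁺`, `L⁻` are Lipschitz constants of the weighting functions. -/
def CPTFunction.lipConst (C : CPTFunction) (Lp Lm : ℝ≥0) {k : ℕ} (o : Fin k → ℝ) : ℝ :=
  (⨆ i, |C.u (o i)|) * max (Lp : ℝ) (Lm : ℝ) * (2 * (k : ℝ) ^ 2 + k)

section Value

variable {S : Type u} {A : Type v} [Finite S] [Finite A] {M : MDP S A}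

open Classical in
/-- The CPT-valuation of the random variable `Φ` under the path measure of the strategy `σ`. -/
def strategyValue (Φ : WRObjective S) (C : CPTFunction) (σ : Strategy M) : ℝ :=
  (∑ o ∈ Φ.outc.filter (fun o => 0 < o),
    C.u o * (C.wPlus (σ.prob {ρ | o ≤ Φ.value ρ}) - C.wPlus (σ.prob {ρ | o < Φ.value ρ}))) +
  ∑ o ∈ Φ.outc.filter (fun o => o < 0),
    C.u o * (C.wMinus (σ.prob {ρ | Φ.value ρ ≤ o}) - C.wMinus (σ.prob {ρ | Φ.value ρ < o}))

/-- The CPT-value of an MDP: the supremum over all history-dependent randomized strategies. -/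
def cptVal (M : MDP S A) (Φ : WRObjective S) (C : CPTFunction) : ℝ :=
  ⨆ σ : Strategy M, strategyValue Φ C σ

end Value

/-! ### Line 1: the transformation to a stopping MDP (quotient by end components) -/

section Quotient

variable {S : Type u} {A : Type v}

/-- `C = (T, B)` is an end component. The actions in `B` are tagged with their state, which makes
the action sets of different states disjoint. -/
structure MDP.IsEC (M : MDP S A) (C : Set S × Set (S × A)) : Prop where
  nonempty : C.1.Nonempty
  actions_nonempty : C.2.Nonempty
  actions_avail : ∀ x ∈ C.2, x.1 ∈ C.1 ∧ x.2 ∈ M.avail x.1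
  closed : ∀ x ∈ C.2, (M.δ x.1 x.2).support ⊆ C.1
  connected : ∀ s ∈ C.1, ∀ t ∈ C.1,
    Relation.TransGen (fun q q' => ∃ a, (q, a) ∈ C.2 ∧ M.δ q a q' ≠ 0) s t

/-- `C` is a maximal end component within the set of states `X`. -/
def MDP.IsMECIn (M : MDP S A) (X : Set S) (C : Set S × Set (S × A)) : Prop :=
  Maximal (fun D : Set S × Set (S × A) => M.IsEC D ∧ D.1 ⊆ X) C

/-- The non-target maximal end components. -/
abbrev MDP.NTMEC (M : MDP S A) (Φ : WRObjective S) : Type (max u v) :=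
  {C : Set S × Set (S × A) // M.IsMECIn Φ.targetᶜ C}

/-- States of the quotient: the states outside all non-target maximal end components, one
representative for each of these components, and the sink `none`. -/
abbrev MDP.QState (M : MDP S A) (Φ : WRObjective S) : Type (max u v) :=
  Option ({s : S // ∀ C : M.NTMEC Φ, s ∉ C.1.1} ⊕ M.NTMEC Φ)

/-- Actions of the quotient: the original actions, tagged with their state, and the action
`stay`, which is `none`. -/
abbrev QAction (S : Type u) (A : Type v) : Type (max u v) := Option (S × A)

open Classical in
/-- The state of the quotient that represents an original state (distinct maximal end components
are disjoint, so the choice below is no choice). -/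
def MDP.proj (M : MDP S A) (Φ : WRObjective S) (s : S) : M.QState Φ :=
  if h : ∃ C : M.NTMEC Φ, s ∈ C.1.1 then some (Sum.inr h.choose)
  else some (Sum.inl ⟨s, fun C hC => h ⟨C, hC⟩⟩)

/-- Actions available in a state of the quotient: an original state keeps its actions, the
representative of a component `(T, B)` has all actions of states in `T` outside `B` together
with `stay`, and the sink has only `stay`. -/
def MDP.qAvail (M : MDP S A) (Φ : WRObjective S) : M.QState Φ → Set (QAction S A)
  | none => {none}
  | some (Sum.inl s) => {x | ∃ a ∈ M.avail s.1, x = some (s.1, a)}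
  | some (Sum.inr C) =>
      insert none {x | ∃ s ∈ C.1.1, ∃ a ∈ M.avail s, (s, a) ∉ C.1.2 ∧ x = some (s, a)}

/-- Transitions of the quotient: `stay` leads to the sink, and an original action leads to the
representatives of its original successors. -/
def MDP.qδ (M : MDP S A) (Φ : WRObjective S) : QAction S A → PMF (M.QState Φ)
  | none => PMF.pure none
  | some (s, a) => (M.δ s a).map (M.proj Φ)

/-- The stopping transformation. -/
def makeStopping (M : MDP S A) (Φ : WRObjective S) : MDP (M.QState Φ) (QAction S A) where
  init := M.proj Φ M.init
  avail := M.qAvail Φ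
  avail_nonempty := by
    rintro (_ | s | C)
    · exact ⟨none, rfl⟩
    · obtain ⟨a, ha⟩ := M.avail_nonempty s.1
      exact ⟨some (s.1, a), a, ha, rfl⟩
    · exact ⟨none, Or.inl rfl⟩
  δ := fun _ x => M.qδ Φ x

/-- The objective on the quotient: the same target states with the same rewards. -/
def liftObjective (M : MDP S A) (Φ : WRObjective S) : WRObjective (M.QState Φ) where
  target := {q | ∃ s, q = some (Sum.inl s) ∧ s.1 ∈ Φ.target}
  reward
    | some (Sum.inl s) => Φ.reward s.1
    | _ => 0

end Quotient

/-! ### Line 2: the multi-objective reachability query, and its Pareto frontier -/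

section Query

variable {S : Type u} {A : Type v}

open Classical in
/-- The states of a stopping MDP with sink `z` that obtain the outcome `o`. -/
def obtainset (Φ : WRObjective S) (z : S) (o : ℝ) : Set S :=
  if o = 0 then {z} else {s | s ∈ Φ.target ∧ (Φ.reward s : ℝ) = o}

/-- The query with one set of target states for each outcome. -/
def query (Φ : WRObjective S) (z : S) {k : ℕ} (o : Fin k → ℝ) : Fin k → Set S :=
  fun i => obtainset Φ z (o i)

variable [Finite S] [Finite A]

/-- The achievable points of a multi-objective reachability query. -/
def achievable (M : MDP S A) {k : ℕ} (Q : Fin k → Set S) : Set (Fin k → ℝ) :=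
  {p | ∃ σ : Strategy M, ∀ i, p i ≤ σ.prob (reach (Q i))}

/-- The Pareto frontier of a multi-objective reachability query. -/
def paretoFrontier (M : MDP S A) {k : ℕ} (Q : Fin k → Set S) : Set (Fin k → ℝ) :=
  {p | p ∈ achievable M Q ∧ ¬ ∃ q ∈ achievable M Q, p ≠ q ∧ p ≤ q}

end Query

/-! ### Line 3: approximations of the Pareto frontier -/

/-- The Euclidean distance. -/
def l2dist {k : ℕ} (p q : Fin k → ℝ) : ℝ := Real.sqrt (∑ i, (p i - q i) ^ 2)

/-- The set represented by a finite set of extreme points: all their convex combinations. -/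
def hull {k : ℕ} (E : Finset (Fin k → ℝ)) : Set (Fin k → ℝ) :=
  convexHull ℝ (E : Set (Fin k → ℝ))

/-- The finite set `E` of achievable probability vectors represents an `ε`-approximation of the
Pareto frontier: each of the two sets is contained in the closed `ε`-neighbourhood of the other. -/
structure IsFrontierApprox {S : Type u} {A : Type v} [Finite S] [Finite A] (M : MDP S A) {k : ℕ}
    (Q : Fin k → Set S) (ε : ℝ) (E : Finset (Fin k → ℝ)) : Prop where
  nonneg : ∀ p ∈ E, 0 ≤ p
  achievable : ∀ p ∈ E, p ∈ achievable M Q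
  close : ∀ p ∈ hull E, ∃ q ∈ paretoFrontier M Q, l2dist p q ≤ ε
  cover : ∀ q ∈ paretoFrontier M Q, ∃ p ∈ hull E, l2dist p q ≤ ε

/-! ### Line 4: optimization over a grid -/

open Classical in
/-- Side length `ε / (L √k)` of the hypercubes (if `L = 0`, the unit cube need not be divided). -/
def gridSide (L ε : ℝ) (k : ℕ) : ℝ := if L = 0 then 1 else ε / (L * Real.sqrt k)

/-- Number of hypercubes in each dimension. -/
def gridNum (L ε : ℝ) (k : ℕ) : ℕ := ⌈1 / gridSide L ε k⌉₊

/-- The hypercube with index `j`; together, these hypercubes cover `[0, 1]ᵏ`. -/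
def gridCube (L ε : ℝ) {k : ℕ} (j : Fin k → Fin (gridNum L ε k)) : Set (Fin k → ℝ) :=
  {p | ∀ i, ((j i : ℕ) : ℝ) * gridSide L ε k ≤ p i ∧
    p i ≤ (((j i : ℕ) : ℝ) + 1) * gridSide L ε k}

/-- `v` is a possible result of the grid optimization of `f` over `P`: for each hypercube that meets
`P`, some vector in the intersection is selected, and `v` is the maximum of `f` over these. -/
def IsGridMax {k : ℕ} (L ε : ℝ) (P : Set (Fin k → ℝ)) (f : (Fin k → ℝ) → ℝ) (v : ℝ) : Prop :=
  ∃ c : (Fin k → Fin (gridNum L ε k)) → (Fin k → ℝ),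
    (∀ j, (gridCube L ε j ∩ P).Nonempty → c j ∈ gridCube L ε j ∩ P) ∧
    IsGreatest {y | ∃ j, (gridCube L ε j ∩ P).Nonempty ∧ y = f (c j)} v

/-! ### The whole algorithm -/

/-- `v` is a possible output of the algorithm on the MDP `M`, the objective `Φ`, the CPT-function
`C` (whose weighting functions have Lipschitz constants `Lp` and `Lm`) and the precision `ε`. -/
def AlgorithmOutput {S : Type u} {A : Type v} [Finite S] [Finite A] (M : MDP S A)
    (Φ : WRObjective S) (C : CPTFunction) (Lp Lm : ℝ≥0) (ε v : ℝ) : Prop :=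
  let M' := makeStopping M Φ
  let Q := query (liftObjective M Φ) none Φ.outcomes
  ∃ E : Finset (Fin Φ.numOutc → ℝ), IsFrontierApprox M' Q ε E ∧
    IsGridMax (C.lipConst Lp Lm Φ.outcomes) ε (hull E) (C.cpt Φ.outcomes) v

end

end CPTMDP

namespace CPTMDP

open MeasureTheory ProbabilityTheory Preorder Filter Topology

/-! ### One-step laws of the path measure and expectations along a strategy. -/

section Markov

/-! Let `outcomeVec` be the distribution of Φ under a strategy of the MDP, and `queryVec` the vector
of reachability probabilities under a strategy of the quotient. The CPT-valuation of a strategy is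
the CPT-function at its outcome vector (`strategyValue_eq_cpt`). The core of the proof is that the
set of outcome vectors and the set of query vectors have the same closure (`outcomeVec_mem_closure`,
`queryVec_mem_closure`). Equality of closures is enough because the CPT-function is Lipschitz on
sub-probability vectors (`CPTFunction.abs_cpt_sub_le`).

Both sets are convex, since two strategies can be mixed by weighting their choices with posterior
probabilities (`Strategy.prob_reach_mix`). By Hahn–Banach it remains to compare suprema of linear
functionals. The coordinates sum to 1, so the coordinate of outcome 0 can be eliminated, and a
functional becomes an expected payoff collected in target states.

For such scalar payoffs, value iteration gives a superharmonic majorant `v` that is approached by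
strategies (`MDP.exists_superharmonic`). A majorant on the quotient pulls back to the MDP along
`MDP.proj`. A majorant on the MDP is constant on end components (`MDP.Superharmonic.eq_on_ec`) and
hence descends to the quotient. A superharmonic function bounds the payoff of every strategy as soon
as the states where it does not dominate the payoff are left almost surely. A Lyapunov function
ensures this (`MDP.exists_lyapunov`), and it exists because the quotient has no undecided end
component (`exists_exit`).

In the quotient all query vectors sum to 1, so none dominates another and the Pareto frontier is
exactly the set of query vectors (`paretoFrontier_eq`). Let L be the Lipschitz constant of the
CPT-function. Passing from the frontier to its approximation then costs at most L·ε, and selecting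
one vector per grid cube at most ε. -/

theorem bind_map_mk_apply {S A : Type*} (p : PMF S) (q : S → PMF A) (s : S) (a : A) :
    (p.bind fun s => (q s).map fun a => (s, a)) (s, a) = p s * q s a := by
  classical
  rw [PMF.bind_apply, tsum_eq_single s]
  · congr 1
    rw [PMF.map_apply, tsum_eq_single a]
    · exact if_pos rfl
    · intro b hb
      exact if_neg fun h => hb (congrArg Prod.snd h).symm
  · intro t ht
    rw [PMF.map_apply]
    simp [Ne.symm ht]

theorem bind_map_mk_fst {S A : Type*} (p : PMF S) (q : S → PMF A) :
    (p.bind fun s => (q s).map fun a => (s, a)).map Prod.fst = p := by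
  rw [PMF.map_bind]
  conv_rhs => rw [← PMF.bind_pure p]
  congr 1
  funext s
  rw [PMF.map_comp]
  exact PMF.map_const _ _

theorem map_mk_apply {S A : Type*} (q : PMF A) (t s : S) (a : A) [Decidable (s = t)] :
    (q.map fun a => (t, a)) (s, a) = if s = t then q a else 0 := by
  classical
  rw [PMF.map_apply]
  split_ifs with h
  · subst h
    rw [tsum_eq_single a]
    · simp
    · intro b hb
      simp [Ne.symm hb]
  · simp [h]

variable {S : Type*} {A : Type*} {M : MDP S A}

/-- The last step of a finite path. -/
def lastStep {n : ℕ} (x : Finset.Iic n → Step S A) : Step S A := x ⟨n, Finset.mem_Iic.2 le_rfl⟩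

/-- A finite path, viewed as a history. -/
def toHist {n : ℕ} (x : Finset.Iic n → Step S A) : Fin (n + 1) → Step S A :=
  fun i => x ⟨i, Finset.mem_Iic.2 (Nat.lt_succ_iff.1 i.2)⟩

theorem Strategy.next_apply (σ : Strategy M) (n : ℕ) (x : Finset.Iic n → Step S A) (s : S) (a : A) :
    σ.next n x (s, a) =
      M.δ (lastStep x).1 (lastStep x).2 s * σ.act (n + 1) (toHist x) s a :=
  bind_map_mk_apply _ _ s a

variable [Finite S] [Finite A]

instance (σ : Strategy M) : IsProbabilityMeasure σ.pathMeasure := by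
  unfold Strategy.pathMeasure; infer_instance

/-- The disintegration of the trajectory measure at time `n`. Together with
`Strategy.pathMeasure_zero` it is the only access to the construction of the path measure; all later
step laws follow from these two. -/
theorem Strategy.pathMeasure_cylinder_inter (σ : Strategy M) (n : ℕ)
    (H : Set (Finset.Iic n → Step S A)) (T : Set (Step S A)) :
    σ.pathMeasure {ρ | frestrictLe n ρ ∈ H ∧ ρ (n + 1) ∈ T} =
      ∫⁻ x in H, (σ.next n x).toMeasure T ∂(σ.pathMeasure.map (frestrictLe n)) := by
  have hH : MeasurableSet H := H.toFinite.measurableSet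
  have hT : MeasurableSet T := T.toFinite.measurableSet
  have h := congrArg (fun ν => ν (H ×ˢ T)) (Kernel.map_frestrictLe_trajMeasure_compProd_eq_map_trajMeasure
    (X := fun _ => Step S A) (μ₀ := σ.first.toMeasure) (κ := σ.kernel) (a := n))
  rw [Measure.compProd_apply_prod hH hT, Measure.map_apply (by fun_prop) (hH.prod hT)] at h
  exact h.symm

theorem Strategy.next_toMeasure_fst (σ : Strategy M) (n : ℕ) (x : Finset.Iic n → Step S A) (s : S) :
    (σ.next n x).toMeasure {y : Step S A | y.1 = s} = M.δ (lastStep x).1 (lastStep x).2 s := by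
  have h : (σ.next n x).map Prod.fst = M.δ (lastStep x).1 (lastStep x).2 := bind_map_mk_fst _ _
  let _ : MeasurableSpace S := ⊤
  rw [← h, ← PMF.toMeasure_apply_singleton _ _ (MeasurableSet.singleton s)]
  exact (PMF.toMeasure_map_apply (α := Step S A) (f := Prod.fst) _ _ (fun _ _ => Set.toFinite _ |>.measurableSet)
    (MeasurableSet.singleton s)).symm

theorem Strategy.pathMeasure_zero (σ : Strategy M) (T : Set (Step S A)) :
    σ.pathMeasure {ρ | ρ 0 ∈ T} = σ.first.toMeasure T := by
  have hT : MeasurableSet T := T.toFinite.measurableSet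
  have hE : MeasurableSet {x : Finset.Iic 0 → Step S A | x ⟨0, Finset.mem_Iic.2 le_rfl⟩ ∈ T} :=
    (Set.toFinite _).measurableSet
  have h : σ.pathMeasure.map (frestrictLe 0) =
      σ.first.toMeasure.map (MeasurableEquiv.piUnique fun _ : Finset.Iic 0 => Step S A).symm := by
    unfold Strategy.pathMeasure Kernel.trajMeasure
    rw [Measure.map_comp _ _ (by fun_prop), Kernel.traj_map_frestrictLe, Kernel.partialTraj_self,
      Measure.id_comp]
  have h2 := congrArg (fun ν => ν {x | x ⟨0, Finset.mem_Iic.2 le_rfl⟩ ∈ T}) h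
  rw [Measure.map_apply (by fun_prop) hE, Measure.map_apply (by fun_prop) hE] at h2
  exact h2

theorem Strategy.pathMeasure_next_state (σ : Strategy M) (n : ℕ) (y : Step S A) (s : S) :
    σ.pathMeasure {ρ | ρ n = y ∧ (ρ (n + 1)).1 = s} =
      σ.pathMeasure {ρ | ρ n = y} * M.δ y.1 y.2 s := by
  have hH : MeasurableSet {x : Finset.Iic n → Step S A | lastStep x = y} :=
    (Set.toFinite _).measurableSet
  have h := σ.pathMeasure_cylinder_inter n {x | lastStep x = y} {z | z.1 = s}
  rw [setLIntegral_congr_fun (g := fun _ => M.δ y.1 y.2 s) hH, setLIntegral_const,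
    Measure.map_apply (by fun_prop) hH, mul_comm] at h
  · exact h
  · intro x hx
    have hx : lastStep x = y := hx
    simp only [σ.next_toMeasure_fst, hx]

/-- Serves two purposes: unavailable actions are null, and so are the actions that a deterministic
strategy does not choose. -/
theorem Strategy.pathMeasure_step_eq_zero (σ : Strategy M) (n : ℕ) (s : S) (a : A)
    (h : ∀ x, σ.act n x s a = 0) : σ.pathMeasure {ρ | ρ n = (s, a)} = 0 := by
  classical
  have hT : MeasurableSet {y : Step S A | y = (s, a)} := (Set.toFinite _).measurableSet
  cases n with
  | zero =>
    refine (σ.pathMeasure_zero {y | y = (s, a)}).trans ?_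
    refine (PMF.toMeasure_apply_singleton _ _ hT).trans ?_
    refine (map_mk_apply _ M.init s a).trans ?_
    split_ifs with h'
    · subst h'; exact h _
    · rfl
  | succ n =>
    have h' := σ.pathMeasure_cylinder_inter n Set.univ {y | y = (s, a)}
    rw [lintegral_congr (g := fun _ => 0), lintegral_zero] at h'
    · simpa using h'
    · intro x
      refine (PMF.toMeasure_apply_singleton _ _ hT).trans ?_
      rw [σ.next_apply, h, mul_zero]

theorem Strategy.pathMeasure_not_avail (σ : Strategy M) (n : ℕ) (s : S) (a : A)
    (h : a ∉ M.avail s) : σ.pathMeasure {ρ | ρ n = (s, a)} = 0 :=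
  σ.pathMeasure_step_eq_zero n s a fun x => by
    by_contra hx
    exact h (σ.act_avail n x s ((PMF.mem_support_iff _ _).2 hx))

theorem Strategy.pathMeasure_init (σ : Strategy M) (s : S) [Decidable (s = M.init)] :
    σ.pathMeasure {ρ | (ρ 0).1 = s} = if s = M.init then 1 else 0 := by
  have h : σ.first.map Prod.fst = PMF.pure M.init := by
    unfold Strategy.first
    exact (PMF.map_comp _ _ _).trans (PMF.map_const _ _)
  let _ : MeasurableSpace S := ⊤
  refine (σ.pathMeasure_zero {y | y.1 = s}).trans ?_
  refine (PMF.toMeasure_map_apply (α := Step S A) (f := Prod.fst) _ _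
    (fun _ _ => Set.toFinite _ |>.measurableSet) (MeasurableSet.singleton s)).symm.trans ?_
  refine (congrArg (fun p : PMF S => p.toMeasure {s}) h).trans ?_
  rw [PMF.toMeasure_apply_singleton _ _ (MeasurableSet.singleton s), PMF.pure_apply]
  congr

theorem Strategy.cylinder_succ (σ : Strategy M) {n : ℕ} (x : Finset.Iic n → Step S A) (s : S)
    (a : A) :
    σ.pathMeasure {ρ | frestrictLe n ρ = x ∧ ρ (n + 1) = (s, a)} =
      σ.pathMeasure {ρ | frestrictLe n ρ = x} *
        (M.δ (lastStep x).1 (lastStep x).2 s * σ.act (n + 1) (toHist x) s a) := by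
  have hH : MeasurableSet ({x} : Set (Finset.Iic n → Step S A)) := (Set.toFinite _).measurableSet
  have hT : MeasurableSet {y : Step S A | y = (s, a)} := (Set.toFinite _).measurableSet
  have h := σ.pathMeasure_cylinder_inter n {x} {y | y = (s, a)}
  rw [lintegral_singleton, Measure.map_apply (by fun_prop) hH, mul_comm] at h
  refine h.trans ?_
  rw [← σ.next_apply]
  congr 1
  exact PMF.toMeasure_apply_singleton _ _ hT

/-- Probability that the path starts with a given history. -/
noncomputable def Strategy.histProb (σ : Strategy M) (n : ℕ) (h : Fin n → Step S A) : ℝ :=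
  σ.prob {ρ | ∀ i : Fin n, ρ i = h i}

open Classical in
/-- Probability that a history is continued with a given state. -/
noncomputable def MDP.nextProb (M : MDP S A) : (n : ℕ) → (Fin n → Step S A) → S → ℝ
  | 0, _, s => if s = M.init then 1 else 0
  | n + 1, h, s => (M.δ (h (Fin.last n)).1 (h (Fin.last n)).2 s).toReal

/-- Chain rule that separates the factor of the MDP from that of the strategy. The first does not
depend on the strategy, which is what makes mixing work. -/
theorem Strategy.histProb_succ (σ : Strategy M) (n : ℕ) (h : Fin (n + 1) → Step S A) :
    σ.histProb (n + 1) h = σ.histProb n (Fin.init h) *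
      (M.nextProb n (Fin.init h) (h (Fin.last n)).1 *
        (σ.act n (Fin.init h) (h (Fin.last n)).1 (h (Fin.last n)).2).toReal) := by
  classical
  cases n with
  | zero =>
    have hT : MeasurableSet {y : Step S A | y = h 0} := (Set.toFinite _).measurableSet
    have h0 : σ.histProb 0 (Fin.init h) = 1 := by
      simp [Strategy.histProb, Strategy.prob]
    have h1 : σ.histProb 1 h = (σ.first (h 0)).toReal := by
      have := (σ.pathMeasure_zero {y | y = h 0}).trans (PMF.toMeasure_apply_singleton _ _ hT)
      rw [← this]
      simp [Strategy.histProb, Strategy.prob, Measure.real]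
    have h2 : σ.first (h 0) =
        if (h 0).1 = M.init then σ.act 0 Fin.elim0 M.init (h 0).2 else 0 :=
      map_mk_apply _ M.init (h 0).1 (h 0).2
    have h3 : Fin.init h = Fin.elim0 := Subsingleton.elim _ _
    rw [h0, h1, h2, h3, one_mul]
    simp only [MDP.nextProb, Fin.last_zero]
    split_ifs with h'
    · rw [h', one_mul]
    · simp
  | succ n =>
    let x : Finset.Iic n → Step S A := fun i => h ⟨i, Nat.lt_succ_of_lt (Nat.lt_succ_of_le
      (Finset.mem_Iic.1 i.2))⟩
    have e1 : {ρ : ℕ → Step S A | ∀ i : Fin (n + 1 + 1), ρ i = h i} =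
        {ρ | frestrictLe n ρ = x ∧ ρ (n + 1) = ((h (Fin.last (n + 1))).1, (h (Fin.last (n + 1))).2)} := by
      ext ρ
      constructor
      · intro H
        exact ⟨funext fun i => H ⟨i, Nat.lt_succ_of_lt (Nat.lt_succ_of_le
          (Finset.mem_Iic.1 i.2))⟩, H (Fin.last _)⟩
      · rintro ⟨H1, H2⟩ i
        refine Fin.lastCases ?_ (fun j => ?_) i
        · exact H2
        · exact congrFun H1 ⟨j, Finset.mem_Iic.2 (Nat.lt_succ_iff.1 j.2)⟩
    have e2 : {ρ : ℕ → Step S A | ∀ i : Fin (n + 1), ρ i = Fin.init h i} =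
        {ρ | frestrictLe n ρ = x} := by
      ext ρ
      simp only [Set.mem_ofPred_eq]
      rw [funext_iff (f := frestrictLe n ρ)]
      exact ⟨fun H i => (H ⟨i, Nat.lt_succ_of_le (Finset.mem_Iic.1 i.2)⟩ :),
        fun H i => H ⟨i, Finset.mem_Iic.2 (Nat.lt_succ_iff.1 i.2)⟩⟩
    unfold Strategy.histProb Strategy.prob Measure.real
    rw [e1, e2]
    refine (congrArg ENNReal.toReal (σ.cylinder_succ _ _ _)).trans ?_
    rw [ENNReal.toReal_mul, ENNReal.toReal_mul]
    rfl

/-- The probability of being in a given state at time `n`. -/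
noncomputable def Strategy.stateProb (σ : Strategy M) (n : ℕ) (s : S) : ℝ :=
  σ.prob {ρ | (ρ n).1 = s}

/-- The probability of being in a given state and choosing a given action at time `n`. -/
noncomputable def Strategy.stepProb (σ : Strategy M) (n : ℕ) (s : S) (a : A) : ℝ :=
  σ.prob {ρ | ρ n = (s, a)}

theorem measurableSet_coord (n : ℕ) (T : Set (Step S A)) :
    MeasurableSet {ρ : ℕ → Step S A | ρ n ∈ T} :=
  measurable_pi_apply n T.toFinite.measurableSet

theorem Strategy.stateProb_nonneg (σ : Strategy M) (n : ℕ) (s : S) : 0 ≤ σ.stateProb n s :=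
  measureReal_nonneg

theorem Strategy.stepProb_nonneg (σ : Strategy M) (n : ℕ) (s : S) (a : A) :
    0 ≤ σ.stepProb n s a :=
  measureReal_nonneg

theorem Strategy.prob_coord_mem (σ : Strategy M) (n : ℕ) [Fintype S] (T : Set S)
    [DecidablePred (· ∈ T)] :
    σ.prob {ρ | (ρ n).1 ∈ T} = ∑ s with s ∈ T, σ.stateProb n s := by
  have e : {ρ : ℕ → Step S A | (ρ n).1 ∈ T} =
      ⋃ s ∈ (Finset.univ.filter (· ∈ T)), {ρ | (ρ n).1 = s} := by
    ext; simp
  unfold Strategy.prob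
  rw [e, measureReal_biUnion_finset]
  · rfl
  · intro s _ t _ hst
    exact Set.disjoint_left.2 fun ρ h1 h2 => hst (h1.symm.trans h2)
  · exact fun s _ => measurableSet_coord n {y : Step S A | y.1 = s}

theorem Strategy.sum_stepProb (σ : Strategy M) (n : ℕ) [Fintype A] (s : S) :
    ∑ a, σ.stepProb n s a = σ.stateProb n s := by
  have e : {ρ : ℕ → Step S A | (ρ n).1 = s} =
      ⋃ a ∈ (Finset.univ : Finset A), {ρ | ρ n = (s, a)} := by
    ext ρ
    simp only [Set.mem_ofPred_eq, Finset.mem_univ, Set.iUnion_true, Set.mem_iUnion]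
    exact ⟨fun h => ⟨(ρ n).2, Prod.ext h rfl⟩, fun ⟨a, h⟩ => congrArg Prod.fst h⟩
  unfold Strategy.stateProb Strategy.prob
  rw [e, measureReal_biUnion_finset]
  · rfl
  · intro a _ b _ hst
    exact Set.disjoint_left.2 fun ρ h1 h2 => hst (congrArg Prod.snd (h1.symm.trans h2))
  · exact fun a _ => measurableSet_coord n {y : Step S A | y = (s, a)}

theorem Strategy.stateProb_succ (σ : Strategy M) (n : ℕ) [Fintype S] [Fintype A] (s : S) :
    σ.stateProb (n + 1) s = ∑ t, ∑ a, σ.stepProb n t a * (M.δ t a s).toReal := by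
  have e : {ρ : ℕ → Step S A | (ρ (n + 1)).1 = s} =
      ⋃ y ∈ (Finset.univ : Finset (S × A)), {ρ | ρ n = y ∧ (ρ (n + 1)).1 = s} := by
    ext ρ
    simp only [Set.mem_ofPred_eq, Finset.mem_univ, Set.iUnion_true, Set.mem_iUnion]
    exact ⟨fun h => ⟨ρ n, rfl, h⟩, fun ⟨a, h⟩ => h.2⟩
  unfold Strategy.stateProb Strategy.prob
  rw [e, measureReal_biUnion_finset, Fintype.sum_prod_type]
  · refine Finset.sum_congr rfl fun t _ => Finset.sum_congr rfl fun a _ => ?_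
    refine (congrArg ENNReal.toReal (σ.pathMeasure_next_state n (t, a) s)).trans ?_
    rw [ENNReal.toReal_mul]
    rfl
  · intro a _ b _ hst
    exact Set.disjoint_left.2 fun ρ h1 h2 => hst (h1.1.symm.trans h2.1)
  · exact fun y _ => (measurableSet_coord n {z : Step S A | z = y}).inter
      (measurableSet_coord (n + 1) {z : Step S A | z.1 = s})

theorem Strategy.stepProb_eq_zero (σ : Strategy M) (n : ℕ) (s : S) (a : A)
    (h : ∀ x, σ.act n x s a = 0) : σ.stepProb n s a = 0 := by
  simp [Strategy.stepProb, Strategy.prob, Measure.real, σ.pathMeasure_step_eq_zero n s a h]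

theorem Strategy.mem_avail_of_stepProb_ne_zero (σ : Strategy M) {n : ℕ} {s : S} {a : A}
    (h : σ.stepProb n s a ≠ 0) : a ∈ M.avail s := by
  by_contra hx
  refine h ?_
  simp [Strategy.stepProb, Strategy.prob, Measure.real, σ.pathMeasure_not_avail n s a hx]

/-! ### Expectations of functions of the current state -/

/-- Expectation of a function under a distribution on a finite type. -/
noncomputable def expect {S : Type*} [Fintype S] (p : PMF S) (f : S → ℝ) : ℝ :=
  ∑ s, (p s).toReal * f s

theorem sum_toReal_eq_one {S : Type*} [Fintype S] (p : PMF S) : ∑ s, (p s).toReal = 1 := by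
  rw [← ENNReal.toReal_sum fun s _ => p.apply_ne_top s, ← tsum_fintype (L := .unconditional S), p.tsum_coe,
    ENNReal.toReal_one]

theorem expect_const {S : Type*} [Fintype S] (p : PMF S) (c : ℝ) : expect p (fun _ => c) = c := by
  rw [expect, ← Finset.sum_mul, sum_toReal_eq_one, one_mul]

theorem expect_congr {S : Type*} [Fintype S] {p : PMF S} {f g : S → ℝ}
    (h : ∀ s ∈ p.support, f s = g s) : expect p f = expect p g := by
  refine Finset.sum_congr rfl fun s _ => ?_
  by_cases hs : s ∈ p.support
  · rw [h s hs]
  · rw [(PMF.apply_eq_zero_iff p s).2 hs]; simp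

theorem expect_mono {S : Type*} [Fintype S] {p : PMF S} {f g : S → ℝ}
    (h : ∀ s ∈ p.support, f s ≤ g s) : expect p f ≤ expect p g := by
  refine Finset.sum_le_sum fun s _ => ?_
  by_cases hs : s ∈ p.support
  · exact mul_le_mul_of_nonneg_left (h s hs) ENNReal.toReal_nonneg
  · rw [(PMF.apply_eq_zero_iff p s).2 hs]; simp

theorem expect_pure {S : Type*} [Fintype S] (s : S) (f : S → ℝ) : expect (PMF.pure s) f = f s := by
  rw [expect_congr (g := fun _ => f s), expect_const]
  intro t ht
  rw [PMF.mem_support_pure_iff] at ht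
  rw [ht]

theorem expect_map {S T : Type*} [Fintype S] [Fintype T] (p : PMF S) (g : S → T) (f : T → ℝ) :
    expect (p.map g) f = expect p (fun s => f (g s)) := by
  classical
  unfold expect
  have h : ∀ t, ((p.map g) t).toReal = ∑ s, if t = g s then (p s).toReal else 0 := by
    intro t
    rw [PMF.map_apply, tsum_fintype, ENNReal.toReal_sum]
    · exact Finset.sum_congr rfl fun s _ => by split_ifs <;> simp
    · intro s _; split_ifs
      · exact p.apply_ne_top s
      · simp
  simp only [h, Finset.sum_mul]
  rw [Finset.sum_comm]
  exact Finset.sum_congr rfl fun s _ => by simp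

theorem expect_neg {S : Type*} [Fintype S] (p : PMF S) (f : S → ℝ) :
    expect p (fun s => -f s) = -expect p f := by
  simp [expect]

theorem expect_sub_const {S : Type*} [Fintype S] (p : PMF S) (f : S → ℝ) (c : ℝ) :
    expect p (fun s => f s - c) = expect p f - c := by
  simp only [expect, mul_sub, Finset.sum_sub_distrib]
  rw [← Finset.sum_mul, sum_toReal_eq_one, one_mul]

/-- Expectation of a function of the state at time `n`. -/
noncomputable def Strategy.ev [Fintype S] (σ : Strategy M) (n : ℕ) (f : S → ℝ) : ℝ :=
  ∑ s, σ.stateProb n s * f s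

theorem Strategy.ev_zero [Fintype S] (σ : Strategy M) (f : S → ℝ) : σ.ev 0 f = f M.init := by
  classical
  have h : ∀ s, σ.stateProb 0 s = if s = M.init then 1 else 0 := by
    intro s
    rw [Strategy.stateProb, Strategy.prob, Measure.real, σ.pathMeasure_init]
    split_ifs <;> simp
  simp [Strategy.ev, h]

theorem Strategy.ev_mono [Fintype S] (σ : Strategy M) (n : ℕ) {f g : S → ℝ} (h : ∀ s, f s ≤ g s) :
    σ.ev n f ≤ σ.ev n g :=
  Finset.sum_le_sum fun s _ => mul_le_mul_of_nonneg_left (h s) (σ.stateProb_nonneg n s)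

theorem Strategy.ev_neg [Fintype S] (σ : Strategy M) (n : ℕ) (f : S → ℝ) :
    σ.ev n (fun s => -f s) = -σ.ev n f := by
  simp [Strategy.ev]

theorem Strategy.ev_sub [Fintype S] (σ : Strategy M) (n : ℕ) (f g : S → ℝ) :
    σ.ev n (fun s => f s - g s) = σ.ev n f - σ.ev n g := by
  simp [Strategy.ev, mul_sub]

theorem Strategy.ev_eq [Fintype S] [Fintype A] (σ : Strategy M) (n : ℕ) (f : S → ℝ) :
    σ.ev n f = ∑ s, ∑ a, σ.stepProb n s a * f s := by
  simp only [Strategy.ev, ← σ.sum_stepProb, Finset.sum_mul]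

theorem Strategy.ev_succ [Fintype S] [Fintype A] (σ : Strategy M) (n : ℕ) (f : S → ℝ) :
    σ.ev (n + 1) f = ∑ s, ∑ a, σ.stepProb n s a * expect (M.δ s a) f := by
  simp only [Strategy.ev, σ.stateProb_succ, Finset.sum_mul, expect, Finset.mul_sum]
  rw [Finset.sum_comm]
  refine Finset.sum_congr rfl fun s _ => ?_
  rw [Finset.sum_comm]
  exact Finset.sum_congr rfl fun a _ => Finset.sum_congr rfl fun t _ => by ring

/-- The hypothesis concerns only steps of positive probability, so that it can be verified for the
actions that one particular strategy plays. -/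
theorem Strategy.ev_le_ev_succ [Fintype S] (σ : Strategy M) (n : ℕ) {f g : S → ℝ}
    (h : ∀ s a, σ.stepProb n s a ≠ 0 → f s ≤ expect (M.δ s a) g) :
    σ.ev n f ≤ σ.ev (n + 1) g := by
  cases nonempty_fintype A
  rw [σ.ev_eq, σ.ev_succ]
  refine Finset.sum_le_sum fun s _ => Finset.sum_le_sum fun a _ => ?_
  by_cases h0 : σ.stepProb n s a = 0
  · simp [h0]
  · exact mul_le_mul_of_nonneg_left (h s a h0) (σ.stepProb_nonneg n s a)

theorem Strategy.ev_succ_le_ev [Fintype S] (σ : Strategy M) (n : ℕ) {f g : S → ℝ}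
    (h : ∀ s, ∀ a ∈ M.avail s, expect (M.δ s a) g ≤ f s) :
    σ.ev (n + 1) g ≤ σ.ev n f := by
  have := σ.ev_le_ev_succ n (f := fun s => -f s) (g := fun s => -g s) fun s a hsa => by
    rw [expect_neg]
    exact neg_le_neg (h s a (σ.mem_avail_of_stepProb_ne_zero hsa))
  rw [σ.ev_neg, σ.ev_neg] at this
  linarith

/-- A function that does not increase in expectation, whatever action is chosen. -/
def MDP.Superharmonic [Fintype S] (M : MDP S A) (f : S → ℝ) : Prop :=
  ∀ s, ∀ a ∈ M.avail s, expect (M.δ s a) f ≤ f s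

theorem Strategy.ev_le_init [Fintype S] (σ : Strategy M) {f : S → ℝ} (h : M.Superharmonic f)
    (n : ℕ) : σ.ev n f ≤ f M.init := by
  induction n with
  | zero => rw [σ.ev_zero]
  | succ n ih => exact (σ.ev_succ_le_ev n h).trans ih

end Markov

/-! ### Reachability as a limit of state probabilities, and mixtures of strategies. -/

section Reach

variable {S : Type*} {A : Type*} {M : MDP S A}

/-- A set of states all of whose members are absorbing. -/
def MDP.AbsorbingOn (M : MDP S A) (T : Set S) : Prop :=
  ∀ s ∈ T, ∀ a ∈ M.avail s, M.δ s a = PMF.pure s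

/-- Choose actions deterministically, depending on the time and the current state only. -/
noncomputable def Strategy.markov (π : ℕ → S → A) (h : ∀ n s, π n s ∈ M.avail s) : Strategy M where
  act n _ s := PMF.pure (π n s)
  act_avail n _ s a ha := by
    rw [PMF.mem_support_pure_iff] at ha
    exact ha ▸ h n s

instance : Nonempty (Strategy M) :=
  ⟨Strategy.markov (fun _ s => (M.avail_nonempty s).some) fun _ s => (M.avail_nonempty s).some_mem⟩

theorem state_eq_of_absorbed {T : Set S} {ρ : ℕ → Step S A}
    (h : ∀ n, (ρ n).1 ∈ T → (ρ (n + 1)).1 = (ρ n).1) {n m : ℕ} (hn : (ρ n).1 ∈ T) (hm : n ≤ m) :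
    (ρ m).1 = (ρ n).1 := by
  induction m, hm using Nat.le_induction with
  | base => rfl
  | succ m _ ih => rw [h m (ih ▸ hn), ih]

variable [Finite S] [Finite A]

theorem Strategy.eq_of_markov_stepProb_ne_zero {π : ℕ → S → A} {h : ∀ n s, π n s ∈ M.avail s}
    {n : ℕ} {s : S} {a : A} (hn : (Strategy.markov π h).stepProb n s a ≠ 0) : a = π n s := by
  classical
  by_contra ha
  refine hn (Strategy.stepProb_eq_zero _ n s a fun _ => ?_)
  simp [Strategy.markov, ha]

/-- There are finitely many violating transitions at each time. Each is null, because its action is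
either unavailable, hence null, or available, hence a self-loop. -/
theorem Strategy.ae_absorbed (σ : Strategy M) {T : Set S} (hT : M.AbsorbingOn T) :
    ∀ᵐ ρ ∂σ.pathMeasure, ∀ n, (ρ n).1 ∈ T → (ρ (n + 1)).1 = (ρ n).1 := by
  rw [ae_all_iff]
  intro n
  have key : ∀ y : S × A, ∀ s : S, y.1 ∈ T → s ≠ y.1 →
      ∀ᵐ ρ ∂σ.pathMeasure, ¬ (ρ n = y ∧ (ρ (n + 1)).1 = s) := by
    classical
    intro y s hy hs
    have h0 : σ.pathMeasure {ρ | ρ n = y ∧ (ρ (n + 1)).1 = s} = 0 := by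
      refine (σ.pathMeasure_next_state n y s).trans ?_
      by_cases ha : y.2 ∈ M.avail y.1
      · rw [hT y.1 hy y.2 ha, PMF.pure_apply, if_neg hs, mul_zero]
      · rw [show σ.pathMeasure {ρ | ρ n = y} = 0 from σ.pathMeasure_not_avail n y.1 y.2 ha, zero_mul]
    rw [ae_iff]
    simp only [not_not]
    exact h0
  have key' : ∀ᵐ ρ ∂σ.pathMeasure, ∀ y : S × A, ∀ s : S, y.1 ∈ T → s ≠ y.1 →
      ¬ (ρ n = y ∧ (ρ (n + 1)).1 = s) := by
    rw [ae_all_iff]; intro y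
    rw [ae_all_iff]; intro s
    by_cases hy : y.1 ∈ T
    · by_cases hs : s = y.1
      · simp [hs]
      · filter_upwards [key y s hy hs] with ρ h _ _ using h
    · simp [hy]
  filter_upwards [key'] with ρ h hn
  by_contra hne
  exact h (ρ n) _ hn hne ⟨rfl, rfl⟩

/-- Having visited an absorbing set by time `n` is almost surely the same as being in it at time
`n`, and the former events increase to `reach T`. Reachability is thereby reduced to one-time
marginals. -/
theorem Strategy.tendsto_prob_reach (σ : Strategy M) {T : Set S} (hT : M.AbsorbingOn T) :
    Tendsto (fun n => σ.prob {ρ | (ρ n).1 ∈ T}) atTop (𝓝 (σ.prob (reach T))) := by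
  have e : (reach T : Set (ℕ → Step S A)) = ⋃ n, {ρ | ∃ j ≤ n, (ρ j).1 ∈ T} := by
    ext ρ
    simp only [reach, Set.mem_ofPred_eq, Set.mem_iUnion]
    exact ⟨fun ⟨j, h⟩ => ⟨j, j, le_rfl, h⟩, fun ⟨_, j, _, h⟩ => ⟨j, h⟩⟩
  have hmono : Monotone fun n : ℕ => {ρ : ℕ → Step S A | ∃ j ≤ n, (ρ j).1 ∈ T} :=
    fun n m hnm ρ ⟨j, hj, h⟩ => ⟨j, hj.trans hnm, h⟩
  have ht := tendsto_measure_iUnion_atTop (μ := σ.pathMeasure) hmono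
  rw [← e] at ht
  have ht' := (ENNReal.tendsto_toReal (measure_ne_top σ.pathMeasure (reach T))).comp ht
  refine ht'.congr fun n => ?_
  refine congrArg ENNReal.toReal (measure_congr ?_)
  filter_upwards [σ.ae_absorbed hT] with ρ h
  refine propext ⟨?_, fun hn => ⟨n, le_rfl, hn⟩⟩
  rintro ⟨j, hj, hjT⟩
  have := state_eq_of_absorbed h hjT hj
  change (ρ n).1 ∈ T
  rwa [this]

/-! ### Mixing two strategies -/

/-- Convex combination of two distributions. -/
noncomputable def mixPMF {A : Type*} (p q : PMF A) (w : ℝ≥0) (hw : w ≤ 1) : PMF A :=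
  (PMF.ofFintype (fun b : Bool => ((if b then w else 1 - w : ℝ≥0) : ℝ≥0∞)) (by
    simp only [Fintype.sum_bool, if_true, Bool.false_eq_true, if_false]
    rw [← ENNReal.coe_add, add_tsub_cancel_of_le hw, ENNReal.coe_one])).bind
    fun b => if b then p else q

theorem mixPMF_apply {A : Type*} (p q : PMF A) (w : ℝ≥0) (hw : w ≤ 1) (a : A) :
    (mixPMF p q w hw a).toReal = w * (p a).toReal + (1 - w) * (q a).toReal := by
  rw [mixPMF, PMF.bind_apply, tsum_fintype, Fintype.sum_bool]
  simp only [PMF.ofFintype_apply, if_true, Bool.false_eq_true, if_false]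
  have h1 : ((1 - w : ℝ≥0) : ℝ≥0∞) * q a ≠ ⊤ :=
    ENNReal.mul_ne_top ENNReal.coe_ne_top (q.apply_ne_top a)
  have h2 : (w : ℝ≥0∞) * p a ≠ ⊤ := ENNReal.mul_ne_top ENNReal.coe_ne_top (p.apply_ne_top a)
  rw [ENNReal.toReal_add h2 h1, ENNReal.toReal_mul, ENNReal.toReal_mul, ENNReal.coe_toReal,
    ENNReal.coe_toReal, NNReal.coe_sub hw, NNReal.coe_one]

/-- The posterior weight of the first strategy, given a history. -/
noncomputable def posterior (σ τ : Strategy M) (a b : ℝ≥0) (n : ℕ) (h : Fin n → Step S A) : ℝ≥0 :=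
  a * (σ.histProb n h).toNNReal / (a * (σ.histProb n h).toNNReal + b * (τ.histProb n h).toNNReal)

theorem posterior_le_one (σ τ : Strategy M) (a b : ℝ≥0) (n : ℕ) (h : Fin n → Step S A) :
    posterior σ τ a b n h ≤ 1 :=
  div_le_one_of_le₀ (le_add_of_nonneg_right zero_le) zero_le

/-- Play `σ` with probability `a` and `τ` with probability `b`. -/
noncomputable def Strategy.mix (σ τ : Strategy M) (a b : ℝ≥0) : Strategy M where
  act n h s := mixPMF (σ.act n h s) (τ.act n h s) _ (posterior_le_one σ τ a b n h)
  act_avail n h s := by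
    unfold mixPMF
    rw [PMF.support_bind]
    refine Set.iUnion₂_subset fun c _ => ?_
    cases c
    · simpa using τ.act_avail n h s
    · simpa using σ.act_avail n h s

theorem Strategy.histProb_nonneg (σ : Strategy M) (n : ℕ) (h : Fin n → Step S A) :
    0 ≤ σ.histProb n h := measureReal_nonneg

/-- By Bayes, the posterior weight times the mixed probability of the history is `a` times its
probability under `σ`; this reproduces the convex combination at the next step. -/
theorem Strategy.histProb_mix (σ τ : Strategy M) {a b : ℝ≥0} (hab : a + b = 1) (n : ℕ)
    (h : Fin n → Step S A) :
    (σ.mix τ a b).histProb n h = a * σ.histProb n h + b * τ.histProb n h := by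
  induction n with
  | zero =>
    have : (a : ℝ) + b = 1 := by exact_mod_cast hab
    simp [Strategy.histProb, Strategy.prob, this]
  | succ n ih =>
    rw [Strategy.histProb_succ, Strategy.histProb_succ, Strategy.histProb_succ, ih]
    simp only [Strategy.mix, mixPMF_apply]
    have hw : (posterior σ τ a b n (Fin.init h) : ℝ) = a * σ.histProb n (Fin.init h) /
        (a * σ.histProb n (Fin.init h) + b * τ.histProb n (Fin.init h)) := by
      simp [posterior, Real.coe_toNNReal _ (Strategy.histProb_nonneg _ _ _)]
    rw [hw]
    have hx := mul_nonneg a.coe_nonneg (σ.histProb_nonneg n (Fin.init h))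
    have hy := mul_nonneg b.coe_nonneg (τ.histProb_nonneg n (Fin.init h))
    set x := (a : ℝ) * σ.histProb n (Fin.init h)
    set y := (b : ℝ) * τ.histProb n (Fin.init h)
    rw [← mul_assoc (a : ℝ), ← mul_assoc (b : ℝ)]
    change (x + y) * _ = x * _ + y * _
    -- A history that is null in the mixture has posterior 0/0, but then every term vanishes and its
    -- value does not matter.
    by_cases h0 : x + y = 0
    · have hx0 : x = 0 := by linarith
      have hy0 : y = 0 := by linarith
      rw [hx0, hy0]; ring
    · field_simp
      ring

theorem Strategy.stateProb_eq_sum_histProb [Fintype (Step S A)] [DecidableEq S]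
    (σ : Strategy M) (n : ℕ) (s : S) :
    σ.stateProb n s = ∑ h : Fin (n + 1) → Step S A with (h (Fin.last n)).1 = s, σ.histProb (n + 1) h := by
  have e : {ρ : ℕ → Step S A | (ρ n).1 = s} =
      ⋃ h ∈ Finset.univ.filter (fun h : Fin (n + 1) → Step S A => (h (Fin.last n)).1 = s),
        {ρ | ∀ i : Fin (n + 1), ρ i = h i} := by
    ext ρ
    simp only [Set.mem_ofPred_eq, Set.mem_iUnion, Finset.mem_filter, Finset.mem_univ, true_and,
      exists_prop]
    exact ⟨fun h => ⟨fun i => ρ i, h, fun i => rfl⟩, fun ⟨h, h1, h2⟩ =>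
      (congrArg Prod.fst (h2 (Fin.last n))).trans h1⟩
  unfold Strategy.stateProb Strategy.prob
  rw [e, measureReal_biUnion_finset]
  · rfl
  · intro h _ h' _ hne
    exact Set.disjoint_left.2 fun ρ h1 h2 => hne (funext fun i => (h1 i).symm.trans (h2 i))
  · intro h _
    have e' : {ρ : ℕ → Step S A | ∀ i : Fin (n + 1), ρ i = h i} =
        ⋂ i : Fin (n + 1), {ρ | ρ i = h i} := by ext; simp
    rw [e']
    exact MeasurableSet.iInter fun i => measurableSet_coord i {y : Step S A | y = h i}

theorem Strategy.stateProb_mix (σ τ : Strategy M) {a b : ℝ≥0} (hab : a + b = 1) (n : ℕ) (s : S) :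
    (σ.mix τ a b).stateProb n s = a * σ.stateProb n s + b * τ.stateProb n s := by
  classical
  cases nonempty_fintype (Step S A)
  simp only [Strategy.stateProb_eq_sum_histProb, Strategy.histProb_mix _ _ hab,
    Finset.sum_add_distrib, Finset.mul_sum]

theorem Strategy.prob_reach_mix (σ τ : Strategy M) {a b : ℝ≥0} (hab : a + b = 1) {T : Set S}
    (hT : M.AbsorbingOn T) :
    (σ.mix τ a b).prob (reach T) = a * σ.prob (reach T) + b * τ.prob (reach T) := by
  classical
  cases nonempty_fintype S
  refine tendsto_nhds_unique ((σ.mix τ a b).tendsto_prob_reach hT) ?_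
  refine (((σ.tendsto_prob_reach hT).const_mul _).add
    ((τ.tendsto_prob_reach hT).const_mul _)).congr fun n => ?_
  simp only [Strategy.prob_coord_mem, Strategy.stateProb_mix _ _ hab, Finset.sum_add_distrib,
    Finset.mul_sum]

end Reach

/-! ### Optimal stopping, superharmonic majorants and Lyapunov functions. -/

section ValueIteration

variable {S : Type*} {A : Type*} [Finite A]

/-- Attractor construction: layer `n + 1` adds the states in which every available action enters
layer `n` with positive probability. The rank is the first layer that contains the state. -/
theorem MDP.exists_rank (M : MDP S A) (X : Set S)
    (hX : ∀ Y ⊆ X, Y.Nonempty → ∃ s ∈ Y, ∀ a ∈ M.avail s, ∃ t ∉ Y, t ∈ (M.δ s a).support) :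
    ∃ r : S → ℕ, ∀ s ∈ X, ∀ a ∈ M.avail s, ∃ t ∈ (M.δ s a).support, r t < r s := by
  classical
  let L : ℕ → Set S := fun n => Nat.rec Xᶜ
    (fun _ L => L ∪ {s | ∀ a ∈ M.avail s, ∃ t ∈ (M.δ s a).support, t ∈ L}) n
  have hLs : ∀ n, L (n + 1) = L n ∪ {s | ∀ a ∈ M.avail s, ∃ t ∈ (M.δ s a).support, t ∈ L n} :=
    fun n => rfl
  have hmono : Monotone L := monotone_nat_of_le_succ fun n => by
    rw [hLs]; exact Set.subset_union_left
  have hall : ∀ s, ∃ n, s ∈ L n := by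
    by_contra! hne
    -- The states in no layer form a subset of `X`. If it is non-empty, some member leaves it under
    -- each action; as there are finitely many actions, it enters one common layer, a contradiction.
    let Y : Set S := {s | ∀ n, s ∉ L n}
    obtain ⟨s, hs, h⟩ := hX Y (fun s hs => not_not.1 (hs 0)) hne
    have : Nonempty S := ⟨s⟩
    choose! t ht hts using h
    have hL : ∀ a, ∃ n, a ∈ M.avail s → t a ∈ L n := fun a => by
      by_cases ha : a ∈ M.avail s
      · have := ht a ha
        simp only [Y, Set.mem_ofPred_eq, not_forall, not_not] at this
        obtain ⟨n, hn⟩ := this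
        exact ⟨n, fun _ => hn⟩
      · exact ⟨0, fun h => absurd h ha⟩
    choose n hn using hL
    obtain ⟨N, hN⟩ := (Set.finite_range n).bddAbove
    refine hs (N + 1) ?_
    rw [hLs]
    exact Or.inr fun a ha => ⟨t a, hts a ha, hmono (hN ⟨a, rfl⟩) (hn a ha)⟩
  have hmin : ∀ s, ∃ n, s ∈ L n ∧ ∀ m, s ∈ L m → n ≤ m := fun s =>
    ⟨sInf {n | s ∈ L n}, Nat.sInf_mem (hall s), fun m h => Nat.sInf_le h⟩
  choose r hr hrmin using hmin
  refine ⟨r, fun s hs a ha => ?_⟩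
  have hspec := hr s
  obtain ⟨m, hm⟩ : ∃ m, r s = m + 1 := by
    refine Nat.exists_eq_succ_of_ne_zero fun h0 => ?_
    rw [h0] at hspec
    exact hspec hs
  rw [hm, hLs] at hspec
  obtain ⟨t, ht, htL⟩ := (hspec.resolve_left fun h => by have := hrmin s m h; omega) a ha
  have := hrmin t m htL
  exact ⟨t, ht, by omega⟩

variable [Fintype S]

theorem expect_tendsto (p : PMF S) {f : ℕ → S → ℝ} {g : S → ℝ}
    (h : ∀ s, Tendsto (fun n => f n s) atTop (𝓝 (g s))) :
    Tendsto (fun n => expect p (f n)) atTop (𝓝 (expect p g)) :=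
  tendsto_finsetSum _ fun s _ => (h s).const_mul _

theorem MDP.exists_best_action (M : MDP S A) (f : S → ℝ) (s : S) :
    ∃ a ∈ M.avail s, ∀ b ∈ M.avail s, expect (M.δ s b) f ≤ expect (M.δ s a) f :=
  Set.exists_max_image _ _ (Set.toFinite _) (M.avail_nonempty s)

/-- An optimal action for the expected value of `f` after one step. -/
noncomputable def MDP.best (M : MDP S A) (f : S → ℝ) (s : S) : A :=
  (M.exists_best_action f s).choose

theorem MDP.best_mem (M : MDP S A) (f : S → ℝ) (s : S) : M.best f s ∈ M.avail s :=
  (M.exists_best_action f s).choose_spec.1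

theorem MDP.le_best (M : MDP S A) (f : S → ℝ) {s : S} {b : A} (hb : b ∈ M.avail s) :
    expect (M.δ s b) f ≤ expect (M.δ s (M.best f s)) f :=
  (M.exists_best_action f s).choose_spec.2 b hb

/-- Optimal values of stopping within `n` steps with payoff `g`. -/
noncomputable def MDP.stopValue (M : MDP S A) (g : S → ℝ) : ℕ → S → ℝ
  | 0 => g
  | n + 1 => fun s =>
    max (g s) (expect (M.δ s (M.best (M.stopValue g n) s)) (M.stopValue g n))

theorem MDP.le_stopValue (M : MDP S A) (g : S → ℝ) (n : ℕ) (s : S) : g s ≤ M.stopValue g n s := by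
  cases n with
  | zero => exact le_rfl
  | succ n => exact le_max_left _ _

theorem MDP.expect_stopValue_le (M : MDP S A) (g : S → ℝ) (n : ℕ) {s : S} {a : A}
    (ha : a ∈ M.avail s) : expect (M.δ s a) (M.stopValue g n) ≤ M.stopValue g (n + 1) s :=
  (M.le_best _ ha).trans (le_max_right _ _)

theorem MDP.stopValue_le_succ (M : MDP S A) (g : S → ℝ) (n : ℕ) (s : S) :
    M.stopValue g n s ≤ M.stopValue g (n + 1) s := by
  induction n generalizing s with
  | zero => exact M.le_stopValue g 1 s
  | succ n ih =>
    refine max_le (M.le_stopValue g _ s) ?_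
    exact (expect_mono fun t _ => ih t).trans (M.expect_stopValue_le g (n + 1) (M.best_mem _ _))

theorem MDP.stopValue_le (M : MDP S A) {g : S → ℝ} {K : ℝ} (hK : ∀ s, g s ≤ K) (n : ℕ) (s : S) :
    M.stopValue g n s ≤ K := by
  induction n generalizing s with
  | zero => exact hK s
  | succ n ih =>
    refine max_le (hK s) ?_
    exact (expect_mono fun t _ => ih t).trans (expect_const _ K).le

/-- The value of optimal stopping is superharmonic and attained in the limit, provided that the
payoff `g` can be preserved for ever. -/
theorem MDP.exists_superharmonic_stopping (M : MDP S A) (g : S → ℝ)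
    (hg : ∀ s, ∃ a ∈ M.avail s, g s ≤ expect (M.δ s a) g) :
    ∃ v : S → ℝ, M.Superharmonic v ∧ (∀ s, g s ≤ v s) ∧
      ∀ η > 0, ∃ (σ : Strategy M) (N : ℕ), ∀ t ≥ N, v M.init - η ≤ σ.ev t g := by
  classical
  obtain ⟨K, hK⟩ := (Set.finite_range g).bddAbove
  have hK : ∀ s, g s ≤ K := fun s => hK ⟨s, rfl⟩
  have hlim : ∀ s, Tendsto (fun n => M.stopValue g n s) atTop (𝓝 (⨆ n, M.stopValue g n s)) :=
    fun s => tendsto_atTop_ciSup (monotone_nat_of_le_succ fun n => M.stopValue_le_succ g n s)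
      ⟨K, by rintro _ ⟨n, rfl⟩; exact M.stopValue_le hK n s⟩
  have hle : ∀ n s, M.stopValue g n s ≤ ⨆ n, M.stopValue g n s := fun n s =>
    le_ciSup (f := fun n => M.stopValue g n s)
      ⟨K, by rintro _ ⟨n, rfl⟩; exact M.stopValue_le hK n s⟩ n
  refine ⟨fun s => ⨆ n, M.stopValue g n s, ?_, fun s => hle 0 s, ?_⟩
  · intro s a ha
    exact le_of_tendsto' (expect_tendsto _ hlim) fun n =>
      (M.expect_stopValue_le g n ha).trans (hle (n + 1) s)
  intro η hη
  choose hold hold_mem hold_le using hg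
  obtain ⟨N, hN⟩ := ((hlim M.init).eventually (lt_mem_nhds (sub_lt_self _ hη))).exists
  -- With `N - t` steps to go, continue optimally if this strictly beats stopping. Stopping means
  -- playing an action that preserves `g`.
  let π : ℕ → S → A := fun t s =>
    if t < N ∧ g s < expect (M.δ s (M.best (M.stopValue g (N - t - 1)) s)) (M.stopValue g (N - t - 1))
    then M.best (M.stopValue g (N - t - 1)) s else hold s
  have hπ : ∀ t s, π t s ∈ M.avail s := fun t s => by
    dsimp only [π]
    split_ifs
    · exact M.best_mem _ _
    · exact hold_mem s
  let σ : Strategy M := Strategy.markov π hπ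
  -- The value with the remaining horizon is a submartingale under `σ`. After time `N` truncated
  -- subtraction leaves horizon 0, where the value is `g` itself.
  have hstep : ∀ t, σ.ev t (M.stopValue g (N - t)) ≤ σ.ev (t + 1) (M.stopValue g (N - (t + 1))) := by
    intro t
    refine σ.ev_le_ev_succ t fun s a hsa => ?_
    have ha : a = π t s := Strategy.eq_of_markov_stepProb_ne_zero hsa
    rw [ha]
    by_cases ht : t < N
    · obtain ⟨m, hm⟩ : ∃ m, N - t = m + 1 := ⟨N - t - 1, by omega⟩
      have hm' : N - (t + 1) = m := by omega
      have hm1 : N - t - 1 = m := by omega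
      rw [hm', hm]
      dsimp only [π]
      rw [hm1]
      split_ifs with hc
      · exact max_le hc.2.le le_rfl
      · have hc' := not_lt.1 fun h => hc ⟨ht, h⟩
        refine (max_le le_rfl hc').trans ((hold_le s).trans ?_)
        exact expect_mono fun u _ => M.le_stopValue g m u
    · have h1 : N - t = 0 := by omega
      have h2 : N - (t + 1) = 0 := by omega
      rw [h1, h2]
      dsimp only [π]
      rw [if_neg fun h => ht h.1]
      exact hold_le s
  have hmono : ∀ t, M.stopValue g N M.init ≤ σ.ev t (M.stopValue g (N - t)) := by
    intro t
    induction t with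
    | zero => rw [σ.ev_zero]; exact le_rfl
    | succ t ih => exact ih.trans (hstep t)
  refine ⟨σ, N, fun t ht => hN.le.trans ?_⟩
  have := hmono t
  rwa [Nat.sub_eq_zero_of_le ht] at this

/-- Lowering `b` to its minimum on `X` yields a payoff that can be preserved everywhere: any action
will do inside `X`, the given one outside. -/
theorem MDP.exists_superharmonic (M : MDP S A) (X : Set S) (b : S → ℝ)
    (hold : ∀ s ∉ X, ∃ a ∈ M.avail s, ∀ t ∈ (M.δ s a).support, t ∉ X ∧ b t = b s) :
    ∃ v : S → ℝ, M.Superharmonic v ∧ (∀ s ∉ X, b s ≤ v s) ∧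
      ∀ η > 0, ∃ (σ : Strategy M) (N : ℕ), ∀ t ≥ N, v M.init - η ≤ σ.ev t b := by
  classical
  obtain ⟨K, hK⟩ := (Set.finite_range b).bddBelow
  have hK : ∀ s, K ≤ b s := fun s => hK ⟨s, rfl⟩
  let g : S → ℝ := fun s => if s ∈ X then K else b s
  have hgb : ∀ s, g s ≤ b s := fun s => by
    dsimp only [g]; split_ifs
    · exact hK s
    · exact le_rfl
  have hKg : ∀ s, K ≤ g s := fun s => by
    dsimp only [g]; split_ifs
    · exact le_rfl
    · exact hK s
  obtain ⟨v, hv, hgv, hσ⟩ := M.exists_superharmonic_stopping g fun s => by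
    by_cases hs : s ∈ X
    · obtain ⟨a, ha⟩ := M.avail_nonempty s
      refine ⟨a, ha, ?_⟩
      rw [show g s = K from if_pos hs, ← expect_const (M.δ s a) K]
      exact expect_mono fun t _ => hKg t
    · obtain ⟨a, ha, h⟩ := hold s hs
      refine ⟨a, ha, ?_⟩
      rw [expect_congr (g := fun _ => g s), expect_const]
      intro t ht
      simp only [g, if_neg hs, if_neg (h t ht).1, (h t ht).2]
  refine ⟨v, hv, fun s hs => ?_, fun η hη => ?_⟩
  · simpa only [g, if_neg hs] using hgv s
  · obtain ⟨σ, N, h⟩ := hσ η hη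
    exact ⟨σ, N, fun t ht => (h t ht).trans (σ.ev_mono t hgb)⟩

/-- A function that decreases in expectation by at least `1` in the states of `X`. -/
def MDP.Lyapunov (M : MDP S A) (X : Set S) (W : S → ℝ) : Prop :=
  (∀ s, 0 ≤ W s) ∧ M.Superharmonic W ∧ ∀ s ∈ X, ∀ a ∈ M.avail s, expect (M.δ s a) W ≤ W s - 1

/-- Summing the drift inequality bounds the expected number of visits to `X` by the initial value of
`W`; the terms of a convergent series tend to 0. -/
theorem Strategy.tendsto_prob_of_lyapunov {M : MDP S A} (σ : Strategy M) {X : Set S} {W : S → ℝ}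
    (hW : M.Lyapunov X W) : Tendsto (fun n => σ.prob {ρ | (ρ n).1 ∈ X}) atTop (𝓝 0) := by
  classical
  let I : S → ℝ := fun s => if s ∈ X then 1 else 0
  have hI : ∀ n, σ.prob {ρ | (ρ n).1 ∈ X} = σ.ev n I := fun n => by
    rw [σ.prob_coord_mem]
    simp [Strategy.ev, I, Finset.sum_filter]
  have hstep : ∀ n, σ.ev (n + 1) W ≤ σ.ev n W - σ.ev n I := fun n => by
    rw [← σ.ev_sub]
    refine σ.ev_succ_le_ev n fun s a ha => ?_
    dsimp only [I]
    split_ifs with hs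
    · exact hW.2.2 s hs a ha
    · rw [sub_zero]; exact hW.2.1 s a ha
  have hsum : ∀ n, ∑ i ∈ Finset.range n, σ.ev i I ≤ W M.init - σ.ev n W := fun n => by
    induction n with
    | zero => simp [σ.ev_zero]
    | succ n ih => rw [Finset.sum_range_succ]; linarith [hstep n]
  have hnn : ∀ n, 0 ≤ σ.ev n W := fun n =>
    Finset.sum_nonneg fun s _ => mul_nonneg (σ.stateProb_nonneg n s) (hW.1 s)
  simp only [hI]
  refine (summable_of_sum_range_le (c := W M.init) (fun n => ?_) fun n => ?_).tendsto_atTop_zero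
  · rw [← hI]; exact measureReal_nonneg
  · linarith [hsum n, hnn n]

/-- Only in `X` can `b` exceed `v`; the excess there is bounded and is weighted by a vanishing
probability. -/
theorem Strategy.lim_ev_le_of_superharmonic {M : MDP S A} (σ : Strategy M) {X : Set S} {W : S → ℝ}
    (hW : M.Lyapunov X W) {v b : S → ℝ} (hv : M.Superharmonic v) (hb : ∀ s ∉ X, b s ≤ v s)
    {l : ℝ} (hl : Tendsto (fun n => σ.ev n b) atTop (𝓝 l)) : l ≤ v M.init := by
  classical
  obtain ⟨K, hK⟩ := (Set.finite_range fun s => b s - v s).bddAbove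
  have hK : ∀ s, b s - v s ≤ K := fun s => hK ⟨s, rfl⟩
  have hle : ∀ n, σ.ev n b ≤ v M.init + σ.prob {ρ | (ρ n).1 ∈ X} * K := fun n => by
    have h1 : σ.ev n (fun s => b s - v s) ≤ σ.ev n (fun s => if s ∈ X then K else 0) := by
      refine σ.ev_mono n fun s => ?_
      split_ifs with hs
      · exact hK s
      · exact sub_nonpos.2 (hb s hs)
    have h2 : σ.ev n (fun s => if s ∈ X then K else 0) = σ.prob {ρ | (ρ n).1 ∈ X} * K := by
      rw [σ.prob_coord_mem]
      simp [Strategy.ev, Finset.sum_filter, Finset.sum_mul, ite_mul]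
    rw [σ.ev_sub, h2] at h1
    linarith [σ.ev_le_init hv n]
  have := le_of_tendsto_of_tendsto' hl
    (tendsto_const_nhds.add ((σ.tendsto_prob_of_lyapunov hW).mul_const K)) hle
  simpa using this

theorem exists_pos_le_transition (M : MDP S A) :
    ∃ p : ℝ, 0 < p ∧ ∀ s a t, t ∈ (M.δ s a).support → p ≤ (M.δ s a t).toReal := by
  let T : Set (S × A × S) := {x | x.2.2 ∈ (M.δ x.1 x.2.1).support}
  rcases T.eq_empty_or_nonempty with h | h
  · refine ⟨1, one_pos, fun s a t ht => ?_⟩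
    have : (s, a, t) ∈ T := ht
    simp [h] at this
  · obtain ⟨x, hx, hmin⟩ := Set.exists_min_image T (fun x => (M.δ x.1 x.2.1 x.2.2).toReal)
      (Set.toFinite _) h
    refine ⟨_, ENNReal.toReal_pos ((PMF.mem_support_iff _ _).1 hx) (PMF.apply_ne_top _ _),
      fun s a t ht => hmin (s, a, t) ht⟩

/-- If every set of transient states can be left whatever is played, a Lyapunov function exists. -/
theorem MDP.exists_lyapunov (M : MDP S A) (X : Set S) (habs : M.AbsorbingOn Xᶜ)
    (hX : ∀ Y ⊆ X, Y.Nonempty → ∃ s ∈ Y, ∀ a ∈ M.avail s, ∃ t ∉ Y, t ∈ (M.δ s a).support) :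
    ∃ W, M.Lyapunov X W := by
  classical
  obtain ⟨r, hr⟩ := M.exists_rank X hX
  obtain ⟨p, hp, hpδ⟩ := exists_pos_le_transition M
  obtain ⟨N, hN⟩ := (Set.finite_range r).bddAbove
  have hN : ∀ s, r s ≤ N := fun s => hN ⟨s, rfl⟩
  -- The Lyapunov function is `K - K * β ^ r`. With probability at least `p ≥ 2 * β` the rank drops,
  -- so the mean of `β ^ r` at least doubles; `K = β ^ (-N)` makes this gain at least 1.
  set β : ℝ := min p 1 / 2 with hβ
  have hβ0 : 0 < β := by positivity
  have hβ1 : β ≤ 1 := by linarith [min_le_right p 1]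
  have hβp : 2 * β ≤ p := by linarith [min_le_left p 1]
  set K : ℝ := (β ^ N)⁻¹ with hK
  have hK0 : 0 < K := by positivity
  have hKr : ∀ s, 1 ≤ K * β ^ r s := fun s => by
    have : β ^ N ≤ β ^ r s := pow_le_pow_of_le_one hβ0.le hβ1 (hN s)
    calc (1 : ℝ) = K * β ^ N := (inv_mul_cancel₀ (by positivity)).symm
      _ ≤ K * β ^ r s := mul_le_mul_of_nonneg_left this hK0.le
  have hdrop : ∀ s ∈ X, ∀ a ∈ M.avail s,
      expect (M.δ s a) (fun t => K - K * β ^ r t) ≤ K - K * β ^ r s - 1 := by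
    intro s hs a ha
    obtain ⟨t, ht, hts⟩ := hr s hs a ha
    have h1 : K * (2 * β ^ r s) ≤ expect (M.δ s a) (fun t => K * β ^ r t) := by
      refine le_trans ?_ (Finset.single_le_sum (f := fun t => (M.δ s a t).toReal * (K * β ^ r t))
        (fun u _ => mul_nonneg ENNReal.toReal_nonneg (by positivity)) (Finset.mem_univ t))
      have h2 : β ^ r s ≤ β ^ (r t + 1) := pow_le_pow_of_le_one hβ0.le hβ1 hts
      have h3 : 2 * β ≤ (M.δ s a t).toReal := hβp.trans (hpδ s a t ht)
      have h4 : 2 * β ^ r s ≤ (M.δ s a t).toReal * β ^ r t := by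
        calc 2 * β ^ r s ≤ 2 * β * β ^ r t := by rw [pow_succ] at h2; linarith
          _ ≤ _ := mul_le_mul_of_nonneg_right h3 (by positivity)
      calc K * (2 * β ^ r s) ≤ K * ((M.δ s a t).toReal * β ^ r t) :=
            mul_le_mul_of_nonneg_left h4 hK0.le
        _ = _ := by ring
    have h5 : expect (M.δ s a) (fun t => K - K * β ^ r t) =
        K - expect (M.δ s a) (fun t => K * β ^ r t) := by
      have := expect_sub_const (M.δ s a) (fun t => K * β ^ r t) K
      rw [← neg_inj, ← expect_neg]
      simpa only [neg_sub] using this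
    rw [h5]
    linarith [hKr s]
  refine ⟨fun s => K - K * β ^ r s, fun s => ?_, fun s a ha => ?_, hdrop⟩
  · have : β ^ r s ≤ 1 := pow_le_one₀ hβ0.le hβ1
    have := mul_le_mul_of_nonneg_left this hK0.le
    linarith
  · by_cases hs : s ∈ X
    · linarith [hdrop s hs a ha]
    · rw [habs s hs a ha, expect_pure]

end ValueIteration

/-! ### End components, the quotient, and the transfer of expected payoffs. -/

section EndComponents

variable {S : Type*} {A : Type*} {M : MDP S A}

/-- Connectedness is stated with a transitive, not reflexive, closure, so even the connection from
`s` to itself has a first edge. -/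
theorem MDP.IsEC.exists_action {C : Set S × Set (S × A)} (hC : M.IsEC C) {s : S} (hs : s ∈ C.1) :
    ∃ a, (s, a) ∈ C.2 := by
  obtain ⟨t, ⟨a, ha, -⟩, -⟩ := Relation.TransGen.head'_iff.1 (hC.connected s hs s hs)
  exact ⟨a, ha⟩

theorem MDP.IsEC.forall_mem {C : Set S × Set (S × A)} (hC : M.IsEC C) {P : S → Prop} {s : S}
    (hs : s ∈ C.1) (hP : P s)
    (hstep : ∀ x ∈ C.2, P x.1 → ∀ t ∈ (M.δ x.1 x.2).support, P t) : ∀ t ∈ C.1, P t := by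
  intro t ht
  have h := hC.connected s hs t ht
  induction h with
  | single h => obtain ⟨a, ha, h⟩ := h; exact hstep _ ha hP _ ((PMF.mem_support_iff _ _).2 h)
  | tail h1 h2 ih =>
    obtain ⟨a, ha, h⟩ := h2
    exact hstep _ ha (ih (hC.actions_avail _ ha).1) _ ((PMF.mem_support_iff _ _).2 h)

theorem MDP.IsEC.union {C D : Set S × Set (S × A)} (hC : M.IsEC C) (hD : M.IsEC D) {u : S}
    (huC : u ∈ C.1) (huD : u ∈ D.1) : M.IsEC (C.1 ∪ D.1, C.2 ∪ D.2) where
  nonempty := ⟨u, Or.inl huC⟩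
  actions_nonempty := hC.actions_nonempty.mono Set.subset_union_left
  actions_avail x hx := by
    rcases hx with hx | hx
    · exact ⟨Or.inl (hC.actions_avail x hx).1, (hC.actions_avail x hx).2⟩
    · exact ⟨Or.inr (hD.actions_avail x hx).1, (hD.actions_avail x hx).2⟩
  closed x hx := by
    rcases hx with hx | hx
    · exact (hC.closed x hx).trans Set.subset_union_left
    · exact (hD.closed x hx).trans Set.subset_union_right
  connected s hs t ht := by
    have h1 : ∀ s ∈ C.1 ∪ D.1, Relation.TransGen
        (fun q q' => ∃ a, (q, a) ∈ C.2 ∪ D.2 ∧ M.δ q a q' ≠ 0) s u := by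
      rintro s (hs | hs)
      · exact Relation.TransGen.mono (fun _ _ ⟨a, ha, h⟩ => ⟨a, Or.inl ha, h⟩) _ _ (hC.connected s hs u huC)
      · exact Relation.TransGen.mono (fun _ _ ⟨a, ha, h⟩ => ⟨a, Or.inr ha, h⟩) _ _ (hD.connected s hs u huD)
    have h2 : ∀ s ∈ C.1 ∪ D.1, Relation.TransGen
        (fun q q' => ∃ a, (q, a) ∈ C.2 ∪ D.2 ∧ M.δ q a q' ≠ 0) u s := by
      rintro s (hs | hs)
      · exact Relation.TransGen.mono (fun _ _ ⟨a, ha, h⟩ => ⟨a, Or.inl ha, h⟩) _ _ (hC.connected u huC s hs)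
      · exact Relation.TransGen.mono (fun _ _ ⟨a, ha, h⟩ => ⟨a, Or.inr ha, h⟩) _ _ (hD.connected u huD s hs)
    exact (h1 s hs).trans (h2 t ht)

variable {Φ : WRObjective S}

theorem MDP.NTMEC.isEC (C : M.NTMEC Φ) : M.IsEC C.1 := C.2.prop.1

theorem MDP.NTMEC.not_mem_target (C : M.NTMEC Φ) {s : S} (hs : s ∈ C.1.1) : s ∉ Φ.target :=
  C.2.prop.2 hs

/-- Two end components that share a state have a union that is again one, so maximality identifies
them. -/
theorem MDP.NTMEC.eq_of_mem {C D : M.NTMEC Φ} {s : S} (hC : s ∈ C.1.1) (hD : s ∈ D.1.1) :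
    C = D := by
  have hU : M.IsEC (C.1.1 ∪ D.1.1, C.1.2 ∪ D.1.2) ∧ C.1.1 ∪ D.1.1 ⊆ Φ.targetᶜ :=
    ⟨C.isEC.union D.isEC hC hD, Set.union_subset C.2.prop.2 D.2.prop.2⟩
  have h1 := C.2.eq_of_ge hU ⟨Set.subset_union_left, Set.subset_union_left⟩
  have h2 := D.2.eq_of_ge hU ⟨Set.subset_union_right, Set.subset_union_right⟩
  exact Subtype.ext (h1.symm.trans h2)

theorem MDP.proj_of_mem {C : M.NTMEC Φ} {s : S} (h : s ∈ C.1.1) :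
    M.proj Φ s = some (Sum.inr C) := by
  have hex : ∃ C : M.NTMEC Φ, s ∈ C.1.1 := ⟨C, h⟩
  rw [MDP.proj, dif_pos hex, MDP.NTMEC.eq_of_mem hex.choose_spec h]

theorem MDP.proj_of_not_mem {s : S} (h : ∀ C : M.NTMEC Φ, s ∉ C.1.1) :
    M.proj Φ s = some (Sum.inl ⟨s, h⟩) := by
  rw [MDP.proj, dif_neg fun ⟨C, hC⟩ => h C hC]

theorem MDP.proj_cases (M : MDP S A) (Φ : WRObjective S) (s : S) :
    (∃ C : M.NTMEC Φ, s ∈ C.1.1 ∧ M.proj Φ s = some (Sum.inr C)) ∨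
      ∃ h : ∀ C : M.NTMEC Φ, s ∉ C.1.1, M.proj Φ s = some (Sum.inl ⟨s, h⟩) := by
  by_cases h : ∃ C : M.NTMEC Φ, s ∈ C.1.1
  · obtain ⟨C, hC⟩ := h
    exact Or.inl ⟨C, hC, MDP.proj_of_mem hC⟩
  · push Not at h
    exact Or.inr ⟨h, MDP.proj_of_not_mem h⟩

theorem MDP.proj_mem_target_iff {s : S} :
    M.proj Φ s ∈ (liftObjective M Φ).target ↔ s ∈ Φ.target := by
  rcases M.proj_cases Φ s with ⟨C, hC, h⟩ | ⟨hs, h⟩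
  · rw [h]
    refine iff_of_false ?_ (C.not_mem_target hC)
    rintro ⟨t, ht, -⟩
    cases ht
  · rw [h]
    constructor
    · rintro ⟨t, ht, hF⟩
      cases ht
      exact hF
    · exact fun h => ⟨_, rfl, h⟩

theorem MDP.reward_proj {s : S} (hs : s ∈ Φ.target) :
    (liftObjective M Φ).reward (M.proj Φ s) = Φ.reward s := by
  rw [MDP.proj_of_not_mem fun C hC => C.not_mem_target hC hs]
  rfl

theorem MDP.proj_surjective_some (q : {s : S // ∀ C : M.NTMEC Φ, s ∉ C.1.1} ⊕ M.NTMEC Φ) :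
    ∃ s, M.proj Φ s = some q := by
  rcases q with s | C
  · exact ⟨s.1, MDP.proj_of_not_mem s.2⟩
  · obtain ⟨s, hs⟩ := C.isEC.nonempty
    exact ⟨s, MDP.proj_of_mem hs⟩

/-- The states of the quotient in which the play is not yet decided. -/
def undecided (M : MDP S A) (Φ : WRObjective S) : Set (M.QState Φ) :=
  {q | q ≠ none ∧ q ∉ (liftObjective M Φ).target}

theorem liftObjective_absorbing (hΦ : Φ.Absorbing M) :
    (makeStopping M Φ).AbsorbingOn (liftObjective M Φ).target := by
  rintro _ ⟨s, rfl, hs⟩ x ⟨a, ha, rfl⟩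
  change (M.δ s.1 a).map (M.proj Φ) = _
  rw [hΦ s.1 hs a ha, PMF.pure_map, MDP.proj_of_not_mem s.2]

theorem sink_absorbing : (makeStopping M Φ).AbsorbingOn {none} := by
  rintro _ rfl x rfl
  rfl

theorem decided_absorbing (hΦ : Φ.Absorbing M) :
    (makeStopping M Φ).AbsorbingOn (undecided M Φ)ᶜ := by
  intro q hq x hx
  by_cases h : q = none
  · exact sink_absorbing q h x hx
  · exact liftObjective_absorbing hΦ q (by_contra fun h' => hq ⟨h, h'⟩) x hx

/-- The quotient has no end components of undecided states. -/
theorem exists_exit [Finite S] [Finite A] (Y : Set (M.QState Φ)) (hY : Y ⊆ undecided M Φ)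
    (hne : Y.Nonempty) : ∃ q ∈ Y, ∀ x ∈ (makeStopping M Φ).avail q,
      ∃ t ∉ Y, t ∈ ((makeStopping M Φ).δ q x).support := by
  by_contra! hcon
  have hnone : none ∉ Y := fun h => (hY h).1 rfl
  -- The original actions that cannot leave the part of the MDP lying over `Y`.
  let D : Set (S × A) := {x | x.2 ∈ M.avail x.1 ∧ ∀ t ∈ (M.δ x.1 x.2).support, M.proj Φ t ∈ Y}
  have hsome : ∀ s a, (∀ t ∉ Y, t ∉ (M.qδ Φ (some (s, a))).support) →
      ∀ t ∈ (M.δ s a).support, M.proj Φ t ∈ Y := by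
    intro s a h t ht
    by_contra hn
    exact h _ hn ((PMF.mem_support_map_iff _ _ _).2 ⟨t, ht, rfl⟩)
  have hCD : ∀ C : M.NTMEC Φ, some (Sum.inr C) ∈ Y → C.1.2 ⊆ D := fun C hC x hx =>
    ⟨(C.isEC.actions_avail x hx).2, fun t ht => by
      rw [MDP.proj_of_mem (C.isEC.closed x hx ht)]; exact hC⟩
  have hact : ∀ s, M.proj Φ s ∈ Y → ∃ a, (s, a) ∈ D := by
    intro s hs
    rcases M.proj_cases Φ s with ⟨C, hC, h⟩ | ⟨hs', h⟩
    · obtain ⟨a, ha⟩ := C.isEC.exists_action hC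
      exact ⟨a, hCD C (h ▸ hs) ha⟩
    · rw [h] at hs
      obtain ⟨x, ⟨a, ha, rfl⟩, hx⟩ := hcon _ hs
      exact ⟨a, ha, hsome s a hx⟩
  let P : Set S → Prop := fun Z => Z.Nonempty ∧ (∀ s ∈ Z, M.proj Φ s ∈ Y) ∧
    ∀ x ∈ D, x.1 ∈ Z → (M.δ x.1 x.2).support ⊆ Z
  have hP : P {s | M.proj Φ s ∈ Y} := by
    refine ⟨?_, fun s hs => hs, fun x hx _ => hx.2⟩
    obtain ⟨q, hq⟩ := hne
    cases q with
    | none => exact absurd hq hnone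
    | some q =>
      obtain ⟨s, hs⟩ := MDP.proj_surjective_some q
      exact ⟨s, by simpa only [Set.mem_ofPred_eq, hs] using hq⟩
  -- A minimal non-empty set over `Y` that is closed under `D` is an end component: the states
  -- reachable from any of its members form another such set, hence all of it.
  obtain ⟨Z, -, hZ⟩ := Set.Finite.exists_le_minimal (Set.toFinite {Z | P Z}) hP
  have hZP : P Z := hZ.prop
  let E : Set S × Set (S × A) := (Z, {x | x ∈ D ∧ x.1 ∈ Z})
  have hE : M.IsEC E := by
    refine ⟨hZP.1, ?_, fun x hx => ⟨hx.2, hx.1.1⟩, fun x hx => hZP.2.2 x hx.1 hx.2, ?_⟩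
    · obtain ⟨s, hs⟩ := hZP.1
      obtain ⟨a, ha⟩ := hact s (hZP.2.1 s hs)
      exact ⟨(s, a), ha, hs⟩
    · intro s hs t ht
      let R : Set S := {t | Relation.TransGen (fun q q' => ∃ a, (q, a) ∈ E.2 ∧ M.δ q a q' ≠ 0) s t}
      have hRZ : R ⊆ Z := by
        intro u hu
        induction hu with
        | single h => obtain ⟨a, ha, h⟩ := h; exact hZP.2.2 _ ha.1 ha.2 ((PMF.mem_support_iff _ _).2 h)
        | tail _ h _ =>
          obtain ⟨a, ha, h⟩ := h; exact hZP.2.2 _ ha.1 ha.2 ((PMF.mem_support_iff _ _).2 h)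
      have hR : P R := by
        refine ⟨?_, fun u hu => hZP.2.1 u (hRZ hu), fun x hx hxR u hu => ?_⟩
        · obtain ⟨a, ha⟩ := hact s (hZP.2.1 s hs)
          obtain ⟨u, hu⟩ := (M.δ s a).support_nonempty
          exact ⟨u, Relation.TransGen.single ⟨a, ⟨ha, hs⟩, (PMF.mem_support_iff _ _).1 hu⟩⟩
        · exact Relation.TransGen.tail hxR ⟨x.2, ⟨hx, hRZ hxR⟩, (PMF.mem_support_iff _ _).1 hu⟩
      exact hZ.le_of_le hR hRZ ht
  have hEF : E.1 ⊆ Φ.targetᶜ := fun s hs hF =>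
    (hY (hZP.2.1 s hs)).2 (MDP.proj_mem_target_iff.2 hF)
  -- Enlarge this end component to a maximal one; its representative lies in `Y`. Its non-exiting
  -- action is not `stay`, which leads to the sink, and it is not an original action either, since
  -- that would belong to `D` and hence to the component.
  obtain ⟨C', hEC', hC'⟩ := Set.Finite.exists_le_maximal
    (Set.toFinite {D : Set S × Set (S × A) | M.IsEC D ∧ D.1 ⊆ Φ.targetᶜ}) ⟨hE, hEF⟩
  let C : M.NTMEC Φ := ⟨C', hC'⟩
  obtain ⟨s, hs⟩ := hZP.1
  have hsC : s ∈ C.1.1 := hEC'.1 hs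
  have hCY : some (Sum.inr C) ∈ Y := by
    rw [← MDP.proj_of_mem hsC]; exact hZP.2.1 s hs
  obtain ⟨x, hx, hxY⟩ := hcon _ hCY
  rcases hx with rfl | ⟨s₁, hs₁, a₁, ha₁, hn, rfl⟩
  · exact hxY none hnone ((PMF.mem_support_pure_iff _ _).2 rfl)
  · have hs₁Z : s₁ ∈ Z := C.isEC.forall_mem (P := (· ∈ Z)) hsC hs
      (fun x hx hxZ => hZP.2.2 x (hCD C hCY hx) hxZ) s₁ hs₁
    exact hn (hEC'.2 ⟨⟨ha₁, hsome s₁ a₁ hxY⟩, hs₁Z⟩)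

/-- The target states with a given reward. -/
def WRObjective.level {S : Type*} (Φ : WRObjective S) (o : ℝ) : Set S :=
  {s | s ∈ Φ.target ∧ (Φ.reward s : ℝ) = o}

open Classical in
/-- The weight of the outcome that a state yields. -/
noncomputable def payoff {S : Type*} (Φ : WRObjective S) {k : ℕ} (o β : Fin k → ℝ) (s : S) : ℝ :=
  ∑ i, if s ∈ Φ.level (o i) then β i else 0

theorem payoff_of_not_mem {S : Type*} {Φ : WRObjective S} {k : ℕ} (o β : Fin k → ℝ) {s : S}
    (hs : s ∉ Φ.target) : payoff Φ o β s = 0 :=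
  Finset.sum_eq_zero fun _ _ => if_neg fun h => hs h.1

theorem payoff_proj {k : ℕ} (o β : Fin k → ℝ) (s : S) :
    payoff (liftObjective M Φ) o β (M.proj Φ s) = payoff Φ o β s := by
  classical
  unfold payoff
  refine Finset.sum_congr rfl fun i _ => if_congr ?_ rfl rfl
  refine and_congr_right_iff.2 ?_ |>.trans (and_congr_left_iff.2 fun _ => MDP.proj_mem_target_iff)
  intro h
  rw [MDP.reward_proj (MDP.proj_mem_target_iff.1 h)]

/-- The expected weight of the outcome of a strategy. -/
noncomputable def Strategy.expPayoff [Finite S] [Finite A] (σ : Strategy M) (Φ : WRObjective S) {k : ℕ}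
    (o β : Fin k → ℝ) : ℝ :=
  ∑ i, β i * σ.prob (reach (Φ.level (o i)))

variable [Fintype S]

/-- Minimum principle: at a minimizer, an action inside the component has all its successors at the
minimum as well, and connectedness spreads this. -/
theorem MDP.Superharmonic.eq_on_ec {v : S → ℝ} (hv : M.Superharmonic v)
    {C : Set S × Set (S × A)} (hC : M.IsEC C) {s t : S} (hs : s ∈ C.1) (ht : t ∈ C.1) :
    v s = v t := by
  obtain ⟨m, hm, hmin⟩ := Set.exists_min_image C.1 v (Set.toFinite _) hC.nonempty
  have key : ∀ t ∈ C.1, v t = v m := by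
    refine hC.forall_mem hm rfl fun x hx hxm t ht => ?_
    have h1 := hv x.1 x.2 (hC.actions_avail x hx).2
    rw [hxm, ← sub_nonpos, ← expect_sub_const] at h1
    have h2 : ∀ u ∈ Finset.univ, 0 ≤ (M.δ x.1 x.2 u).toReal * (v u - v m) := fun u _ => by
      by_cases hu : u ∈ (M.δ x.1 x.2).support
      · exact mul_nonneg ENNReal.toReal_nonneg (sub_nonneg.2 (hmin u (hC.closed x hx hu)))
      · rw [(PMF.apply_eq_zero_iff _ _).2 hu]; simp
    have h3 := (Finset.sum_eq_zero_iff_of_nonneg h2).1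
      (le_antisymm h1 (Finset.sum_nonneg h2)) t (Finset.mem_univ t)
    rcases mul_eq_zero.1 h3 with h | h
    · exact absurd h (ENNReal.toReal_pos ((PMF.mem_support_iff _ _).1 ht) (PMF.apply_ne_top _ _)).ne'
    · linarith
  rw [key s hs, key t ht]

/-- An original action either survives in the quotient, or is internal to a collapsed component and
leaves the projected state unchanged. -/
theorem action_cases [Fintype (M.QState Φ)] (f : M.QState Φ → ℝ) {s : S} {a : A} (ha : a ∈ M.avail s) :
    (∃ x ∈ (makeStopping M Φ).avail (M.proj Φ s),
      expect ((makeStopping M Φ).δ (M.proj Φ s) x) f = expect (M.δ s a) (fun t => f (M.proj Φ t))) ∨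
    (∃ C : M.NTMEC Φ, s ∈ C.1.1) ∧ expect (M.δ s a) (fun t => f (M.proj Φ t)) = f (M.proj Φ s) := by
  have hδ : expect (M.qδ Φ (some (s, a))) f = expect (M.δ s a) (fun t => f (M.proj Φ t)) :=
    expect_map _ _ _
  rcases M.proj_cases Φ s with ⟨C, hC, h⟩ | ⟨hs, h⟩
  · by_cases haC : (s, a) ∈ C.1.2
    · refine Or.inr ⟨⟨C, hC⟩, ?_⟩
      rw [expect_congr (g := fun _ => f (M.proj Φ s)), expect_const]
      intro t ht
      rw [h, MDP.proj_of_mem (C.isEC.closed _ haC ht)]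
    · refine Or.inl ⟨some (s, a), ?_, hδ⟩
      rw [h]
      exact Or.inr ⟨s, hC, a, ha, haC, rfl⟩
  · refine Or.inl ⟨some (s, a), ?_, hδ⟩
    rw [h]
    exact ⟨a, ha, rfl⟩

theorem MDP.Superharmonic.comp_proj [Fintype (M.QState Φ)] {f : M.QState Φ → ℝ}
    (hf : (makeStopping M Φ).Superharmonic f) : M.Superharmonic fun s => f (M.proj Φ s) := by
  intro s a ha
  rcases action_cases f ha with ⟨x, hx, h⟩ | ⟨-, h⟩
  · rw [← h]; exact hf _ x hx
  · exact h.le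

/-- The states outside the target and outside all non-target end components. -/
def transient (M : MDP S A) (Φ : WRObjective S) : Set S :=
  {s | s ∉ Φ.target ∧ ∀ C : M.NTMEC Φ, s ∉ C.1.1}

theorem MDP.Lyapunov.comp_proj [Fintype (M.QState Φ)] {W : M.QState Φ → ℝ}
    (hW : (makeStopping M Φ).Lyapunov (undecided M Φ) W) :
    M.Lyapunov (transient M Φ) fun s => W (M.proj Φ s) := by
  refine ⟨fun s => hW.1 _, hW.2.1.comp_proj, fun s hs a ha => ?_⟩
  rcases action_cases W ha with ⟨x, hx, h⟩ | ⟨⟨C, hC⟩, -⟩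
  · rw [← h]
    refine hW.2.2 _ ⟨?_, fun h => hs.1 (MDP.proj_mem_target_iff.1 h)⟩ x hx
    rw [MDP.proj_of_not_mem hs.2]
    exact Option.some_ne_none _
  · exact absurd hC (hs.2 C)

variable [Finite A]

theorem exists_lyapunov_makeStopping [Fintype (M.QState Φ)] (hΦ : Φ.Absorbing M) :
    ∃ W, (makeStopping M Φ).Lyapunov (undecided M Φ) W :=
  (makeStopping M Φ).exists_lyapunov _ (decided_absorbing hΦ) exists_exit

/-! ### Comparison of the MDP with its quotient -/

theorem Strategy.tendsto_ev_payoff (σ : Strategy M) (hΦ : M.AbsorbingOn Φ.target) {k : ℕ}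
    (o β : Fin k → ℝ) :
    Tendsto (fun n => σ.ev n (payoff Φ o β)) atTop (𝓝 (σ.expPayoff Φ o β)) := by
  classical
  have h : ∀ n, σ.ev n (payoff Φ o β) = ∑ i, β i * σ.prob {ρ | (ρ n).1 ∈ Φ.level (o i)} := by
    intro n
    simp only [Strategy.ev, payoff, Strategy.prob_coord_mem, Finset.mul_sum, Finset.sum_filter]
    rw [Finset.sum_comm]
    exact Finset.sum_congr rfl fun i _ => Finset.sum_congr rfl fun s _ => by split_ifs <;> ring
  simp only [h]
  exact tendsto_finsetSum _ fun i _ =>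
    (σ.tendsto_prob_reach fun s hs => hΦ s hs.1).const_mul _

/-- The majorant of the quotient, pulled back along the projection, bounds the payoff of `σ` and is
nearly attained by some `τ`. -/
theorem exists_strategy_makeStopping [Fintype (M.QState Φ)] (hΦ : Φ.Absorbing M) {k : ℕ}
    (o β : Fin k → ℝ) (σ : Strategy M) {η : ℝ} (hη : 0 < η) :
    ∃ τ : Strategy (makeStopping M Φ),
      σ.expPayoff Φ o β - η ≤ τ.expPayoff (liftObjective M Φ) o β := by
  obtain ⟨W, hW⟩ := exists_lyapunov_makeStopping hΦ
  obtain ⟨v, hv, hbv, hτ⟩ := (makeStopping M Φ).exists_superharmonic (undecided M Φ)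
    (payoff (liftObjective M Φ) o β) fun q hq => by
      obtain ⟨x, hx⟩ := (makeStopping M Φ).avail_nonempty q
      refine ⟨x, hx, fun t ht => ?_⟩
      rw [decided_absorbing hΦ q hq x hx, PMF.mem_support_pure_iff] at ht
      subst ht
      exact ⟨hq, rfl⟩
  obtain ⟨τ, N, hN⟩ := hτ η hη
  have h1 : v (makeStopping M Φ).init - η ≤ τ.expPayoff (liftObjective M Φ) o β :=
    ge_of_tendsto (τ.tendsto_ev_payoff (liftObjective_absorbing hΦ) o β)
      (eventually_atTop.2 ⟨N, hN⟩)
  have hnone : 0 ≤ v none := by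
    have := hbv none fun h => h.1 rfl
    rwa [payoff_of_not_mem] at this
    rintro ⟨s, hs, -⟩
    cases hs
  have h2 : σ.expPayoff Φ o β ≤ v (M.proj Φ M.init) := by
    refine σ.lim_ev_le_of_superharmonic hW.comp_proj hv.comp_proj (fun s hs => ?_)
      (σ.tendsto_ev_payoff hΦ o β)
    by_cases hF : s ∈ Φ.target
    · rw [← payoff_proj (M := M)]
      exact hbv _ fun h => h.2 (MDP.proj_mem_target_iff.2 hF)
    · rw [payoff_of_not_mem o β hF]
      obtain ⟨C, hC⟩ : ∃ C : M.NTMEC Φ, s ∈ C.1.1 := by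
        by_contra! h; exact hs ⟨hF, h⟩
      rw [MDP.proj_of_mem hC]
      refine hnone.trans ?_
      -- Because of `stay`, the majorant on a component is at least its value at the sink, hence at
      -- least the payoff 0 of remaining in the component.
      have h := hv (some (Sum.inr C)) none (Or.inl rfl)
      rwa [show (makeStopping M Φ).δ (some (Sum.inr C)) none = PMF.pure none from rfl,
        expect_pure] at h
  exact ⟨τ, by linarith [show v (makeStopping M Φ).init = v (M.proj Φ M.init) from rfl]⟩

/-- Conversely, the majorant of the MDP is constant on end components and descends to the quotient.
In the MDP, the payoff 0 of a component is preserved by its internal actions. -/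
theorem exists_strategy_of_makeStopping [Fintype (M.QState Φ)] (hΦ : Φ.Absorbing M) {k : ℕ}
    (o β : Fin k → ℝ) (τ : Strategy (makeStopping M Φ)) {η : ℝ} (hη : 0 < η) :
    ∃ σ : Strategy M, τ.expPayoff (liftObjective M Φ) o β - η ≤ σ.expPayoff Φ o β := by
  obtain ⟨W, hW⟩ := exists_lyapunov_makeStopping hΦ
  obtain ⟨v, hv, hbv, hσ⟩ := M.exists_superharmonic (transient M Φ) (payoff Φ o β) fun s hs => by
    by_cases hF : s ∈ Φ.target
    · obtain ⟨a, ha⟩ := M.avail_nonempty s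
      refine ⟨a, ha, fun t ht => ?_⟩
      rw [hΦ s hF a ha, PMF.mem_support_pure_iff] at ht
      subst ht
      exact ⟨hs, rfl⟩
    · obtain ⟨C, hC⟩ : ∃ C : M.NTMEC Φ, s ∈ C.1.1 := by
        by_contra! h; exact hs ⟨hF, h⟩
      obtain ⟨a, ha⟩ := C.isEC.exists_action hC
      refine ⟨a, (C.isEC.actions_avail _ ha).2, fun t ht => ?_⟩
      have htC := C.isEC.closed _ ha ht
      exact ⟨fun h => h.2 C htC, by
        rw [payoff_of_not_mem o β hF, payoff_of_not_mem o β (C.not_mem_target htC)]⟩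
  obtain ⟨σ, N, hN⟩ := hσ η hη
  refine ⟨σ, ?_⟩
  have h1 : v M.init - η ≤ σ.expPayoff Φ o β :=
    ge_of_tendsto (σ.tendsto_ev_payoff hΦ o β) (eventually_atTop.2 ⟨N, hN⟩)
  let w : M.QState Φ → ℝ
    | none => 0
    | some (Sum.inl s) => v s.1
    | some (Sum.inr C) => v C.isEC.nonempty.some
  have hw : ∀ s, w (M.proj Φ s) = v s := by
    intro s
    rcases M.proj_cases Φ s with ⟨C, hC, h⟩ | ⟨hs, h⟩
    · rw [h]
      exact hv.eq_on_ec C.isEC C.isEC.nonempty.some_mem hC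
    · rw [h]
  have hwδ : ∀ s a, expect (M.qδ Φ (some (s, a))) w = expect (M.δ s a) v := fun s a => by
    refine (expect_map _ _ _).trans ?_
    simp only [hw]
  have hw_super : (makeStopping M Φ).Superharmonic w := by
    rintro (_ | s | C) x hx
    · obtain rfl : x = none := hx
      exact (expect_pure _ _).le
    · obtain ⟨a, ha, rfl⟩ := hx
      exact (hwδ s.1 a).trans_le (hv s.1 a ha)
    · rcases hx with rfl | ⟨s, hs, a, ha, -, rfl⟩
      -- The action `stay` leads to `w none = 0`, and `v` is non-negative on the component, where it
      -- dominates the payoff 0.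
      · refine (expect_pure _ _).trans_le ?_
        have hC := C.isEC.nonempty.some_mem
        have := hbv _ fun h : C.isEC.nonempty.some ∈ transient M Φ => h.2 C hC
        rwa [payoff_of_not_mem o β (C.not_mem_target hC)] at this
      · refine (hwδ s a).trans_le ?_
        rw [← MDP.proj_of_mem hs, hw]
        exact hv s a ha
  have h2 : τ.expPayoff (liftObjective M Φ) o β ≤ w (makeStopping M Φ).init := by
    refine τ.lim_ev_le_of_superharmonic hW hw_super (fun q hq => ?_)
      (τ.tendsto_ev_payoff (liftObjective_absorbing hΦ) o β)
    by_cases hF : q ∈ (liftObjective M Φ).target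
    · obtain ⟨s, rfl, hs⟩ := hF
      rw [← MDP.proj_of_not_mem s.2, payoff_proj, hw]
      exact hbv _ fun h => h.1 hs
    · rw [payoff_of_not_mem o β hF]
      obtain rfl : q = none := by_contra fun h => hq ⟨h, hF⟩
      exact le_rfl
  have h3 : w (makeStopping M Φ).init = v M.init := hw _
  linarith

theorem prob_reach_decided [Fintype (M.QState Φ)] (hΦ : Φ.Absorbing M)
    (τ : Strategy (makeStopping M Φ)) : τ.prob (reach (undecided M Φ)ᶜ) = 1 := by
  obtain ⟨W, hW⟩ := exists_lyapunov_makeStopping hΦ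
  have h1 := τ.tendsto_prob_reach (decided_absorbing hΦ)
  have h2 : ∀ n, τ.prob {ρ | (ρ n).1 ∈ (undecided M Φ)ᶜ} =
      1 - τ.prob {ρ | (ρ n).1 ∈ undecided M Φ} := fun n =>
    probReal_compl_eq_one_sub (measurableSet_coord n {y | y.1 ∈ undecided M Φ})
  simp only [h2] at h1
  have h3 := (tendsto_const_nhds (x := (1 : ℝ))).sub (τ.tendsto_prob_of_lyapunov hW)
  rw [sub_zero] at h3
  exact tendsto_nhds_unique h1 h3

end EndComponents

/-! ### Outcome vectors, query vectors and the Pareto frontier. -/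

section Outcomes

variable {S : Type*} {A : Type*}

theorem WRObjective.value_eq_zero {Φ : WRObjective S} {ρ : ℕ → Step S A}
    (h : ∀ n, (ρ n).1 ∉ Φ.target) : Φ.value ρ = 0 := by
  rw [WRObjective.value, dif_neg fun ⟨n, hn⟩ => h n hn]

theorem WRObjective.value_eq_reward {Φ : WRObjective S} {ρ : ℕ → Step S A} {n : ℕ}
    (hn : (ρ n).1 ∈ Φ.target) (hm : ∀ m < n, (ρ m).1 ∉ Φ.target) :
    Φ.value ρ = Φ.reward (ρ n).1 := by
  classical
  have h : ∃ n, (ρ n).1 ∈ Φ.target := ⟨n, hn⟩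
  have hfind : Nat.find h = n := (Nat.find_eq_iff h).2 ⟨hn, hm⟩
  rw [WRObjective.value, dif_pos h, ← hfind]

theorem WRObjective.exists_first {Φ : WRObjective S} {ρ : ℕ → Step S A} {j : ℕ}
    (hj : (ρ j).1 ∈ Φ.target) :
    ∃ n ≤ j, (ρ n).1 ∈ Φ.target ∧ ∀ m < n, (ρ m).1 ∉ Φ.target := by
  classical
  have h : ∃ n, (ρ n).1 ∈ Φ.target := ⟨j, hj⟩
  exact ⟨Nat.find h, Nat.find_min' h hj, Nat.find_spec h, fun m hm => Nat.find_min h hm⟩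

theorem WRObjective.value_eq_iff {Φ : WRObjective S} {x : ℝ} (hx : x ≠ 0) (ρ : ℕ → Step S A) :
    Φ.value ρ = x ↔ ∃ n, (ρ n).1 ∈ Φ.level x ∧ ∀ m < n, (ρ m).1 ∉ Φ.target := by
  constructor
  · intro h
    have : ∃ j, (ρ j).1 ∈ Φ.target := by
      by_contra! h'
      exact hx (h ▸ WRObjective.value_eq_zero h')
    obtain ⟨j, hj⟩ := this
    obtain ⟨n, -, hn, hm⟩ := WRObjective.exists_first hj
    exact ⟨n, ⟨hn, (WRObjective.value_eq_reward hn hm).symm.trans h⟩, hm⟩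
  · rintro ⟨n, hn, hm⟩
    rw [WRObjective.value_eq_reward hn.1 hm, hn.2]

variable [Finite S]

theorem WRObjective.mem_outc {Φ : WRObjective S} {x : ℝ} :
    x ∈ Φ.outc ↔ x = 0 ∨ ∃ s ∈ Φ.target, (Φ.reward s : ℝ) = x := by
  simp [WRObjective.outc]

theorem WRObjective.outcomes_strictMono (Φ : WRObjective S) : StrictMono Φ.outcomes :=
  (Φ.outc.orderEmbOfFin rfl).strictMono

theorem WRObjective.exists_outcomes_eq {Φ : WRObjective S} {x : ℝ} (hx : x ∈ Φ.outc) :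
    ∃ i, Φ.outcomes i = x := by
  have := Finset.range_orderEmbOfFin Φ.outc rfl
  exact (this.symm ▸ hx : x ∈ Set.range (Φ.outc.orderEmbOfFin rfl))

theorem WRObjective.exists_outcomes_eq_zero (Φ : WRObjective S) : ∃ i, Φ.outcomes i = 0 :=
  WRObjective.exists_outcomes_eq (WRObjective.mem_outc.2 (Or.inl rfl))

theorem WRObjective.value_mem_outc (Φ : WRObjective S) (ρ : ℕ → Step S A) : Φ.value ρ ∈ Φ.outc := by
  rw [WRObjective.mem_outc]
  by_cases h : ∃ j, (ρ j).1 ∈ Φ.target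
  · obtain ⟨j, hj⟩ := h
    obtain ⟨n, -, hn, hm⟩ := WRObjective.exists_first hj
    exact Or.inr ⟨_, hn, (WRObjective.value_eq_reward hn hm).symm⟩
  · push Not at h
    exact Or.inl (WRObjective.value_eq_zero h)

variable {M : MDP S A}

theorem query_eq_level {Φ : WRObjective S} {i : Fin Φ.numOutc} (hi : Φ.outcomes i ≠ 0) :
    query (liftObjective M Φ) none Φ.outcomes i = (liftObjective M Φ).level (Φ.outcomes i) := by
  rw [query, obtainset, if_neg hi]
  rfl

theorem query_eq_sink {Φ : WRObjective S} {i : Fin Φ.numOutc} (hi : Φ.outcomes i = 0) :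
    query (liftObjective M Φ) none Φ.outcomes i = {none} := by
  rw [query, obtainset, if_pos hi]

theorem query_absorbing {Φ : WRObjective S} (hΦ : Φ.Absorbing M) (i : Fin Φ.numOutc) :
    (makeStopping M Φ).AbsorbingOn (query (liftObjective M Φ) none Φ.outcomes i) := by
  by_cases hi : Φ.outcomes i = 0
  · rw [query_eq_sink hi]; exact sink_absorbing
  · rw [query_eq_level hi]; exact fun s hs => liftObjective_absorbing hΦ s hs.1

/-- The query sets partition the decided states. Non-zero rewards keep the target states apart from
the set for outcome 0, which is the sink. -/
theorem mem_query_iff {Φ : WRObjective S} (hr : Φ.NonzeroRewards) {q : M.QState Φ}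
    (hq : q ∉ undecided M Φ) :
    ∃ i, ∀ j, q ∈ query (liftObjective M Φ) none Φ.outcomes j ↔ j = i := by
  by_cases h : q = none
  · subst h
    obtain ⟨i₀, hi₀⟩ := Φ.exists_outcomes_eq_zero
    refine ⟨i₀, fun j => ?_⟩
    by_cases hj : Φ.outcomes j = 0
    · rw [query_eq_sink hj]
      exact iff_of_true rfl (Φ.outcomes_strictMono.injective (hj.trans hi₀.symm))
    · rw [query_eq_level hj]
      refine iff_of_false ?_ fun h => hj (h ▸ hi₀)
      rintro ⟨⟨s, hs, -⟩, -⟩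
      cases hs
  · obtain ⟨s, rfl, hs⟩ := by_contra fun h' => hq ⟨h, h'⟩
    obtain ⟨i, hi⟩ := WRObjective.exists_outcomes_eq (Φ := Φ) (WRObjective.mem_outc.2 (Or.inr ⟨s.1, hs, rfl⟩))
    have hne : Φ.outcomes i ≠ 0 := by
      rw [hi]; exact_mod_cast hr s.1 hs
    refine ⟨i, fun j => ?_⟩
    by_cases hj : Φ.outcomes j = 0
    · rw [query_eq_sink hj]
      exact iff_of_false h fun h' => hne (h' ▸ hj)
    · rw [query_eq_level hj]
      refine ⟨fun h => Φ.outcomes_strictMono.injective (h.2.symm.trans hi.symm), ?_⟩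
      rintro rfl
      exact ⟨⟨s, rfl, hs⟩, hi.symm⟩

theorem not_undecided_of_mem_query {Φ : WRObjective S} {q : M.QState Φ} {i : Fin Φ.numOutc}
    (hq : q ∈ query (liftObjective M Φ) none Φ.outcomes i) : q ∉ undecided M Φ := by
  intro h
  by_cases hi : Φ.outcomes i = 0
  · rw [query_eq_sink hi] at hq; exact h.1 hq
  · rw [query_eq_level hi] at hq; exact h.2 hq.1

variable [Finite A]

theorem WRObjective.measurableSet_value_eq (Φ : WRObjective S) (x : ℝ) :
    MeasurableSet {ρ : ℕ → Step S A | Φ.value ρ = x} := by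
  have h : ∀ x ≠ 0, MeasurableSet {ρ : ℕ → Step S A | Φ.value ρ = x} := by
    intro x hx
    have e : {ρ : ℕ → Step S A | Φ.value ρ = x} =
        ⋃ n, ({ρ | (ρ n).1 ∈ Φ.level x} ∩ ⋂ m, ⋂ _ : m < n, {ρ | (ρ m).1 ∉ Φ.target}) := by
      ext ρ
      simp [WRObjective.value_eq_iff hx]
    rw [e]
    refine MeasurableSet.iUnion fun n => (measurableSet_coord n {y | y.1 ∈ Φ.level x}).inter ?_
    exact MeasurableSet.iInter fun m => MeasurableSet.iInter fun _ =>
      measurableSet_coord m {y | y.1 ∉ Φ.target}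
  by_cases hx : x = 0
  · have e : {ρ : ℕ → Step S A | Φ.value ρ = x} =
        (⋃ y ∈ Φ.outc.erase 0, {ρ | Φ.value ρ = y})ᶜ := by
      ext ρ
      have := Φ.value_mem_outc ρ
      simp only [hx, Set.mem_ofPred_eq, Set.mem_compl_iff, Set.mem_iUnion, Finset.mem_erase]
      exact ⟨fun h ⟨y, hy, hy'⟩ => hy.1 (hy'.symm.trans h),
        fun h => by_contra fun h0 => h ⟨_, ⟨h0, this⟩, rfl⟩⟩
    rw [e]
    exact (Finset.measurableSet_biUnion _ fun y hy => h y (Finset.ne_of_mem_erase hy)).compl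
  · exact h x hx

/-- The distribution of the outcome of a strategy. -/
noncomputable def outcomeVec (Φ : WRObjective S) (σ : Strategy M) (i : Fin Φ.numOutc) : ℝ :=
  σ.prob {ρ | Φ.value ρ = Φ.outcomes i}

theorem Strategy.prob_value_mem (Φ : WRObjective S) (σ : Strategy M) (B : Set ℝ)
    [DecidablePred (· ∈ B)] :
    σ.prob {ρ | Φ.value ρ ∈ B} = ∑ i with Φ.outcomes i ∈ B, outcomeVec Φ σ i := by
  have e : {ρ : ℕ → Step S A | Φ.value ρ ∈ B} =
      ⋃ i ∈ Finset.univ.filter (fun i => Φ.outcomes i ∈ B), {ρ | Φ.value ρ = Φ.outcomes i} := by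
    ext ρ
    obtain ⟨i, hi⟩ := WRObjective.exists_outcomes_eq (Φ.value_mem_outc ρ)
    simp only [Set.mem_ofPred_eq, Set.mem_iUnion, Finset.mem_filter, Finset.mem_univ, true_and,
      exists_prop]
    exact ⟨fun h => ⟨i, hi ▸ h, hi.symm⟩, fun ⟨j, hj, h⟩ => h ▸ hj⟩
  unfold Strategy.prob
  rw [e, measureReal_biUnion_finset]
  · rfl
  · intro i _ j _ hij
    exact Set.disjoint_left.2 fun ρ h1 h2 => hij (Φ.outcomes_strictMono.injective (h1.symm.trans h2))
  · exact fun i _ => Φ.measurableSet_value_eq _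

theorem sum_outcomeVec (Φ : WRObjective S) (σ : Strategy M) : ∑ i, outcomeVec Φ σ i = 1 := by
  classical
  have := Strategy.prob_value_mem Φ σ Set.univ
  simpa [Strategy.prob] using this.symm

theorem outcomeVec_nonneg (Φ : WRObjective S) (σ : Strategy M) (i : Fin Φ.numOutc) :
    0 ≤ outcomeVec Φ σ i := measureReal_nonneg

/-- The first visited target state is absorbing, so almost surely it is the only one visited. -/
theorem outcomeVec_eq_reach {Φ : WRObjective S} (hΦ : Φ.Absorbing M) (σ : Strategy M)
    {i : Fin Φ.numOutc} (hi : Φ.outcomes i ≠ 0) :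
    outcomeVec Φ σ i = σ.prob (reach (Φ.level (Φ.outcomes i))) := by
  refine congrArg ENNReal.toReal (measure_congr ?_)
  filter_upwards [σ.ae_absorbed hΦ] with ρ hρ
  refine propext ⟨fun h => ?_, ?_⟩
  · obtain ⟨n, hn, -⟩ := (WRObjective.value_eq_iff hi ρ).1 h
    exact ⟨n, hn⟩
  · rintro ⟨j, hj⟩
    obtain ⟨n, hnj, hn, hm⟩ := WRObjective.exists_first hj.1
    change Φ.value ρ = _
    rw [WRObjective.value_eq_reward hn hm, ← state_eq_of_absorbed hρ hn hnj, hj.2]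

theorem sum_Ici_eq {k : ℕ} (p : Fin k → ℝ) (i : Fin k) : ∑ m ∈ Finset.Ici i, p m = p i + grank p i := by
  rw [grank, ← Finset.Ioi_insert, Finset.sum_insert (by simp)]

theorem sum_Iic_eq {k : ℕ} (p : Fin k → ℝ) (i : Fin k) : ∑ m ∈ Finset.Iic i, p m = p i + lrank p i := by
  rw [lrank, ← Finset.Iio_insert, Finset.sum_insert (by simp)]

/-- Since the outcomes are strictly increasing, tail probabilities of Φ are the partial sums that
define the ranks. -/
theorem strategyValue_eq_cpt (Φ : WRObjective S) (C : CPTFunction) (σ : Strategy M) :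
    strategyValue Φ C σ = C.cpt Φ.outcomes (outcomeVec Φ σ) := by
  classical
  have hmono := Φ.outcomes_strictMono
  have h1 : ∀ i, σ.prob {ρ | Φ.outcomes i ≤ Φ.value ρ} = outcomeVec Φ σ i + grank (outcomeVec Φ σ) i := by
    intro i
    rw [← sum_Ici_eq]
    refine (Strategy.prob_value_mem Φ σ (Set.Ici (Φ.outcomes i))).trans (Finset.sum_congr ?_ fun _ _ => rfl)
    ext m; simp [hmono.le_iff_le]
  have h2 : ∀ i, σ.prob {ρ | Φ.outcomes i < Φ.value ρ} = grank (outcomeVec Φ σ) i := by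
    intro i
    refine (Strategy.prob_value_mem Φ σ (Set.Ioi (Φ.outcomes i))).trans (Finset.sum_congr ?_ fun _ _ => rfl)
    ext m; simp [hmono.lt_iff_lt]
  have h3 : ∀ i, σ.prob {ρ | Φ.value ρ ≤ Φ.outcomes i} = outcomeVec Φ σ i + lrank (outcomeVec Φ σ) i := by
    intro i
    rw [← sum_Iic_eq]
    refine (Strategy.prob_value_mem Φ σ (Set.Iic (Φ.outcomes i))).trans (Finset.sum_congr ?_ fun _ _ => rfl)
    ext m; simp [hmono.le_iff_le]
  have h4 : ∀ i, σ.prob {ρ | Φ.value ρ < Φ.outcomes i} = lrank (outcomeVec Φ σ) i := by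
    intro i
    refine (Strategy.prob_value_mem Φ σ (Set.Iio (Φ.outcomes i))).trans (Finset.sum_congr ?_ fun _ _ => rfl)
    ext m; simp [hmono.lt_iff_lt]
  have hsum : ∀ f : ℝ → ℝ, ∑ x ∈ Φ.outc, f x = ∑ i, f (Φ.outcomes i) := by
    intro f
    conv_lhs => rw [← Finset.map_orderEmbOfFin_univ Φ.outc rfl, Finset.sum_map]
    rfl
  unfold strategyValue CPTFunction.cpt
  rw [Finset.sum_filter, Finset.sum_filter, hsum, hsum, ← Finset.sum_add_distrib]
  refine Finset.sum_congr rfl fun i _ => ?_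
  rw [h1, h2, h3, h4, CPTFunction.decisionWeight]
  split_ifs with ha hb
  · exact absurd ha hb.not_gt
  · ring
  · ring
  · ring

/-- If two vectors have the same sum and differ at most in one component, they are equal. -/
theorem eq_of_sum_eq {k : ℕ} {p q : Fin k → ℝ} (hs : ∑ i, p i = ∑ i, q i) (i₀ : Fin k)
    (h : ∀ i ≠ i₀, p i = q i) : p = q := by
  have h1 : ∑ i, (p i - q i) = p i₀ - q i₀ :=
    Finset.sum_eq_single i₀ (fun i _ hi => by rw [h i hi, sub_self]) fun h => absurd (Finset.mem_univ _) h
  rw [Finset.sum_sub_distrib, hs, sub_self] at h1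
  funext i
  by_cases hi : i = i₀
  · subst hi; linarith
  · exact h i hi

/-- Used with `i₀` the index of outcome 0, which in the MDP is not a reachability event: subtracting
`c i₀` turns a linear functional into a payoff that vanishes off the target. -/
theorem sum_mul_eq_of_sum_eq_one {k : ℕ} {p : Fin k → ℝ} (hp : ∑ i, p i = 1) (c : Fin k → ℝ)
    (i₀ : Fin k) : ∑ i, c i * p i = c i₀ + ∑ i, (c i - c i₀) * p i := by
  simp only [sub_mul, Finset.sum_sub_distrib, ← Finset.mul_sum, hp]
  ring

theorem sum_mul_outcomeVec {Φ : WRObjective S} (hΦ : Φ.Absorbing M) (σ : Strategy M)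
    (c : Fin Φ.numOutc → ℝ) {i₀ : Fin Φ.numOutc} (hi₀ : Φ.outcomes i₀ = 0) :
    ∑ i, c i * outcomeVec Φ σ i =
      c i₀ + σ.expPayoff Φ Φ.outcomes (fun i => c i - c i₀) := by
  rw [sum_mul_eq_of_sum_eq_one (sum_outcomeVec Φ σ) c i₀]
  congr 1
  refine Finset.sum_congr rfl fun i _ => ?_
  by_cases hi : i = i₀
  · simp [hi]
  · rw [outcomeVec_eq_reach hΦ σ fun h => hi (Φ.outcomes_strictMono.injective (h.trans hi₀.symm))]

/-- Mixing is linear on the reachability coordinates; the remaining coordinate, that of outcome 0,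
is forced by the sum. -/
theorem convex_range_outcomeVec {Φ : WRObjective S} (hΦ : Φ.Absorbing M) :
    Convex ℝ (Set.range (outcomeVec (M := M) Φ)) := by
  rintro _ ⟨σ, rfl⟩ _ ⟨τ, rfl⟩ a b ha hb hab
  lift a to ℝ≥0 using ha
  lift b to ℝ≥0 using hb
  have hab' : a + b = 1 := by exact_mod_cast hab
  obtain ⟨i₀, hi₀⟩ := Φ.exists_outcomes_eq_zero
  refine ⟨σ.mix τ a b, eq_of_sum_eq ?_ i₀ fun i hi => ?_⟩
  · simp only [Pi.add_apply, Pi.smul_apply, smul_eq_mul, Finset.sum_add_distrib, ← Finset.mul_sum,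
      sum_outcomeVec]
    linarith
  · have hi' : Φ.outcomes i ≠ 0 := fun h => hi (Φ.outcomes_strictMono.injective (h.trans hi₀.symm))
    simp only [Pi.add_apply, Pi.smul_apply, smul_eq_mul, outcomeVec_eq_reach hΦ _ hi']
    exact σ.prob_reach_mix τ hab' fun s hs => hΦ s hs.1

/-! ### The query on the quotient -/

/-- The point that a strategy of the quotient realizes. -/
noncomputable def queryVec (M : MDP S A) (Φ : WRObjective S) (τ : Strategy (makeStopping M Φ))
    (i : Fin Φ.numOutc) : ℝ :=
  τ.prob (reach (query (liftObjective M Φ) none Φ.outcomes i))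

theorem sum_queryVec {Φ : WRObjective S} (hΦ : Φ.Absorbing M) (hr : Φ.NonzeroRewards)
    (τ : Strategy (makeStopping M Φ)) : ∑ i, queryVec M Φ τ i = 1 := by
  classical
  cases nonempty_fintype S
  cases nonempty_fintype (M.QState Φ)
  rw [← prob_reach_decided hΦ τ]
  refine tendsto_nhds_unique (tendsto_finsetSum Finset.univ fun i _ =>
    τ.tendsto_prob_reach (query_absorbing hΦ i)) ?_
  refine (τ.tendsto_prob_reach (decided_absorbing hΦ)).congr fun n => ?_
  simp only [Strategy.prob_coord_mem, Finset.sum_filter]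
  rw [Finset.sum_comm]
  refine Finset.sum_congr rfl fun q _ => ?_
  by_cases hq : q ∈ undecided M Φ
  · rw [if_neg (Set.notMem_compl_iff.2 hq)]
    exact (Finset.sum_eq_zero fun i _ => if_neg fun h => not_undecided_of_mem_query h hq).symm
  · rw [if_pos (Set.mem_compl hq)]
    obtain ⟨i, hi⟩ := mem_query_iff hr hq
    simp [hi]

theorem queryVec_nonneg {Φ : WRObjective S} (τ : Strategy (makeStopping M Φ)) (i : Fin Φ.numOutc) :
    0 ≤ queryVec M Φ τ i := measureReal_nonneg

theorem sum_mul_queryVec {Φ : WRObjective S} (hΦ : Φ.Absorbing M) (hr : Φ.NonzeroRewards)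
    (τ : Strategy (makeStopping M Φ)) (c : Fin Φ.numOutc → ℝ) {i₀ : Fin Φ.numOutc}
    (hi₀ : Φ.outcomes i₀ = 0) :
    ∑ i, c i * queryVec M Φ τ i =
      c i₀ + τ.expPayoff (liftObjective M Φ) Φ.outcomes (fun i => c i - c i₀) := by
  rw [sum_mul_eq_of_sum_eq_one (sum_queryVec hΦ hr τ) c i₀]
  congr 1
  refine Finset.sum_congr rfl fun i _ => ?_
  by_cases hi : i = i₀
  · simp [hi]
  · rw [queryVec, query_eq_level fun h => hi (Φ.outcomes_strictMono.injective (h.trans hi₀.symm))]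

theorem convex_range_queryVec {Φ : WRObjective S} (hΦ : Φ.Absorbing M) :
    Convex ℝ (Set.range (queryVec M Φ)) := by
  rintro _ ⟨σ, rfl⟩ _ ⟨τ, rfl⟩ a b ha hb hab
  lift a to ℝ≥0 using ha
  lift b to ℝ≥0 using hb
  have hab' : a + b = 1 := by exact_mod_cast hab
  exact ⟨σ.mix τ a b, funext fun i => σ.prob_reach_mix τ hab' (query_absorbing hΦ i)⟩

/-- Hahn–Banach: a point outside the closure would be strictly separated by a functional, and the
hypothesis applied to half-space gap `f x - u` contradicts this. -/
theorem mem_closure_of_support_le {k : ℕ} {B : Set (Fin k → ℝ)} (hB : Convex ℝ B) {x : Fin k → ℝ}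
    (h : ∀ c : Fin k → ℝ, ∀ η > 0, ∃ y ∈ B, ∑ i, c i * x i - η ≤ ∑ i, c i * y i) :
    x ∈ closure B := by
  by_contra hx
  obtain ⟨f, u, hfu, hux⟩ := geometric_hahn_banach_closed_point hB.closure isClosed_closure hx
  have hf : ∀ y : Fin k → ℝ, f y = ∑ i, f (fun j => if i = j then 1 else 0) * y i := by
    intro y
    refine ((f : (Fin k → ℝ) →ₗ[ℝ] ℝ).pi_apply_eq_sum_univ y).trans ?_
    exact Finset.sum_congr rfl fun i _ => mul_comm _ _
  obtain ⟨y, hy, hxy⟩ := h (fun i => f (fun j => if i = j then 1 else 0)) (f x - u) (sub_pos.2 hux)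
  have := hfu y (subset_closure hy)
  rw [← hf, ← hf] at hxy
  linarith

theorem outcomeVec_mem_closure {Φ : WRObjective S} (hΦ : Φ.Absorbing M) (hr : Φ.NonzeroRewards)
    (σ : Strategy M) : outcomeVec Φ σ ∈ closure (Set.range (queryVec M Φ)) := by
  cases nonempty_fintype S
  cases nonempty_fintype (M.QState Φ)
  obtain ⟨i₀, hi₀⟩ := Φ.exists_outcomes_eq_zero
  refine mem_closure_of_support_le (convex_range_queryVec hΦ) fun c η hη => ?_
  obtain ⟨τ, hτ⟩ := exists_strategy_makeStopping hΦ Φ.outcomes (fun i => c i - c i₀) σ hη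
  refine ⟨_, ⟨τ, rfl⟩, ?_⟩
  rw [sum_mul_outcomeVec hΦ σ c hi₀, sum_mul_queryVec hΦ hr τ c hi₀]
  linarith

theorem queryVec_mem_closure {Φ : WRObjective S} (hΦ : Φ.Absorbing M) (hr : Φ.NonzeroRewards)
    (τ : Strategy (makeStopping M Φ)) :
    queryVec M Φ τ ∈ closure (Set.range (outcomeVec (M := M) Φ)) := by
  cases nonempty_fintype S
  cases nonempty_fintype (M.QState Φ)
  obtain ⟨i₀, hi₀⟩ := Φ.exists_outcomes_eq_zero
  refine mem_closure_of_support_le (convex_range_outcomeVec hΦ) fun c η hη => ?_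
  obtain ⟨σ, hσ⟩ := exists_strategy_of_makeStopping hΦ Φ.outcomes (fun i => c i - c i₀) τ hη
  refine ⟨_, ⟨σ, rfl⟩, ?_⟩
  rw [sum_mul_outcomeVec hΦ σ c hi₀, sum_mul_queryVec hΦ hr τ c hi₀]
  linarith

theorem eq_of_le_of_sum_eq {k : ℕ} {p q : Fin k → ℝ} (hpq : p ≤ q) (hs : ∑ i, q i ≤ ∑ i, p i) :
    p = q := by
  funext i
  have h := (Finset.sum_eq_sum_iff_of_le fun i _ => hpq i).1
    (le_antisymm (Finset.sum_le_sum fun i _ => hpq i) hs)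
  exact h i (Finset.mem_univ i)

/-- In the quotient every strategy is Pareto optimal. -/
theorem paretoFrontier_eq {Φ : WRObjective S} (hΦ : Φ.Absorbing M) (hr : Φ.NonzeroRewards) :
    paretoFrontier (makeStopping M Φ) (query (liftObjective M Φ) none Φ.outcomes) =
      Set.range (queryVec M Φ) := by
  ext p
  constructor
  · rintro ⟨⟨τ, hτ⟩, hmax⟩
    by_contra hp
    exact hmax ⟨queryVec M Φ τ, ⟨τ, fun i => le_rfl⟩, fun h => hp ⟨τ, h.symm⟩, hτ⟩
  · rintro ⟨τ, rfl⟩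
    refine ⟨⟨τ, fun i => le_rfl⟩, ?_⟩
    -- A dominating achievable `q` lies below the query vector of `τ'`. Both query vectors sum to 1,
    -- which leaves no room for a strict increase.
    rintro ⟨q, ⟨τ', hτ'⟩, hne, hle⟩
    refine hne (eq_of_le_of_sum_eq hle ?_)
    rw [sum_queryVec hΦ hr τ, ← sum_queryVec hΦ hr τ']
    exact Finset.sum_le_sum fun i _ => hτ' i

end Outcomes

/-! ### Lipschitz estimate for the CPT-function and geometry of the grid. -/

section Analysis

variable {k : ℕ}

/-- The sub-probability vectors. -/
def subprob (k : ℕ) : Set (Fin k → ℝ) := {p | 0 ≤ p ∧ ∑ i, p i ≤ 1}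

theorem convex_subprob : Convex ℝ (subprob k) := by
  intro p hp q hq a b ha hb hab
  refine ⟨add_nonneg (smul_nonneg ha hp.1) (smul_nonneg hb hq.1), ?_⟩
  simp only [Pi.add_apply, Pi.smul_apply, smul_eq_mul, Finset.sum_add_distrib, ← Finset.mul_sum]
  calc a * ∑ i, p i + b * ∑ i, q i ≤ a * 1 + b * 1 :=
        add_le_add (mul_le_mul_of_nonneg_left hp.2 ha) (mul_le_mul_of_nonneg_left hq.2 hb)
    _ = 1 := by linarith

theorem sum_mem_Icc {p : Fin k → ℝ} (hp : p ∈ subprob k) (s : Finset (Fin k)) :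
    ∑ i ∈ s, p i ∈ Set.Icc (0 : ℝ) 1 :=
  ⟨Finset.sum_nonneg fun i _ => hp.1 i,
    (Finset.sum_le_univ_sum_of_nonneg fun i => hp.1 i).trans hp.2⟩

theorem subprob_subset_Icc : subprob k ⊆ Set.Icc 0 1 := fun p hp =>
  ⟨hp.1, fun i => by simpa using (sum_mem_Icc hp {i}).2⟩

theorem l2dist_nonneg (p q : Fin k → ℝ) : 0 ≤ l2dist p q := Real.sqrt_nonneg _

theorem l2dist_comm (p q : Fin k → ℝ) : l2dist p q = l2dist q p := by
  unfold l2dist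
  congr 1
  exact Finset.sum_congr rfl fun i _ => by ring

theorem l2dist_self (p : Fin k → ℝ) : l2dist p p = 0 := by simp [l2dist]

theorem abs_sub_le_l2dist (p q : Fin k → ℝ) (i : Fin k) : |p i - q i| ≤ l2dist p q := by
  rw [← Real.sqrt_sq_eq_abs]
  exact Real.sqrt_le_sqrt (Finset.single_le_sum (f := fun i => (p i - q i) ^ 2)
    (fun i _ => sq_nonneg _) (Finset.mem_univ i))

theorem sum_abs_sub_le (p q : Fin k → ℝ) : ∑ i, |p i - q i| ≤ k * l2dist p q := by
  calc ∑ i, |p i - q i| ≤ ∑ _i : Fin k, l2dist p q :=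
        Finset.sum_le_sum fun i _ => abs_sub_le_l2dist p q i
    _ = k * l2dist p q := by simp

theorem l2dist_le_sqrt_mul {p q : Fin k → ℝ} {d : ℝ} (hd : 0 ≤ d) (h : ∀ i, |p i - q i| ≤ d) :
    l2dist p q ≤ Real.sqrt k * d := by
  rw [← Real.sqrt_sq hd, ← Real.sqrt_mul (Nat.cast_nonneg k)]
  refine Real.sqrt_le_sqrt ?_
  calc ∑ i, (p i - q i) ^ 2 ≤ ∑ _i : Fin k, d ^ 2 :=
        Finset.sum_le_sum fun i _ => by rw [← sq_abs]; exact pow_le_pow_left₀ (abs_nonneg _) (h i) 2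
    _ = k * d ^ 2 := by simp

theorem exists_l2dist_le_of_mem_closure {B : Set (Fin k → ℝ)} {x : Fin k → ℝ}
    (hx : x ∈ closure B) {η : ℝ} (hη : 0 < η) : ∃ y ∈ B, l2dist x y ≤ η := by
  -- The closure refers to the sup metric, which costs a factor `√k`; adding 1 avoids division by
  -- zero.
  have hc : 0 < Real.sqrt k + 1 := by positivity
  obtain ⟨y, hy, hxy⟩ := Metric.mem_closure_iff.1 hx (η / (Real.sqrt k + 1)) (by positivity)
  refine ⟨y, hy, ?_⟩
  have h := l2dist_le_sqrt_mul (p := x) (q := y) (by positivity : 0 ≤ η / (Real.sqrt k + 1))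
    fun i => (dist_le_pi_dist x y i).trans hxy.le
  refine h.trans ?_
  rw [mul_div_assoc', div_le_iff₀ hc]
  nlinarith [Real.sqrt_nonneg (k : ℝ)]

/-! ### Lipschitz continuity of the CPT-function -/

theorem abs_sum_sub_sum_le (p q : Fin k → ℝ) (s : Finset (Fin k)) :
    |∑ i ∈ s, p i - ∑ i ∈ s, q i| ≤ ∑ i, |p i - q i| := by
  rw [← Finset.sum_sub_distrib]
  exact (Finset.abs_sum_le_sum_abs _ _).trans
    (Finset.sum_le_univ_sum_of_nonneg fun i => abs_nonneg _)

theorem abs_weight_sub_le {w : ℝ → ℝ} {L : ℝ≥0} (hw : LipschitzOnWith L w (Set.Icc 0 1))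
    {p q : Fin k → ℝ} (hp : p ∈ subprob k) (hq : q ∈ subprob k) (s t : Finset (Fin k)) :
    |(w (∑ i ∈ s, p i) - w (∑ i ∈ t, p i)) - (w (∑ i ∈ s, q i) - w (∑ i ∈ t, q i))| ≤
      2 * (L * ∑ i, |p i - q i|) := by
  have key : ∀ s : Finset (Fin k), |w (∑ i ∈ s, p i) - w (∑ i ∈ s, q i)| ≤
      L * ∑ i, |p i - q i| := fun s =>
    (hw.dist_le_mul _ (sum_mem_Icc hp s) _ (sum_mem_Icc hq s)).trans
      (mul_le_mul_of_nonneg_left (abs_sum_sub_sum_le p q s) L.coe_nonneg)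
  have h : (w (∑ i ∈ s, p i) - w (∑ i ∈ t, p i)) - (w (∑ i ∈ s, q i) - w (∑ i ∈ t, q i)) =
      (w (∑ i ∈ s, p i) - w (∑ i ∈ s, q i)) - (w (∑ i ∈ t, p i) - w (∑ i ∈ t, q i)) := by ring
  rw [h]
  exact (abs_sub _ _).trans (by linarith [key s, key t])

theorem CPTFunction.abs_decisionWeight_sub_le (C : CPTFunction) {Lp Lm : ℝ≥0}
    (hLp : LipschitzOnWith Lp C.wPlus (Set.Icc 0 1))
    (hLm : LipschitzOnWith Lm C.wMinus (Set.Icc 0 1)) (o : Fin k → ℝ) {p q : Fin k → ℝ}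
    (hp : p ∈ subprob k) (hq : q ∈ subprob k) (i : Fin k) :
    |C.decisionWeight o p i - C.decisionWeight o q i| ≤
      2 * (max (Lp : ℝ) Lm * ∑ i, |p i - q i|) := by
  have hS : 0 ≤ ∑ i, |p i - q i| := Finset.sum_nonneg fun i _ => abs_nonneg _
  unfold CPTFunction.decisionWeight
  rw [← sum_Ici_eq, ← sum_Ici_eq, ← sum_Iic_eq, ← sum_Iic_eq]
  split_ifs
  · refine (abs_weight_sub_le hLp hp hq _ _).trans ?_
    gcongr
    exact le_max_left _ _
  · refine (abs_weight_sub_le hLm hp hq _ _).trans ?_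
    gcongr
    exact le_max_right _ _
  · rw [sub_zero, abs_zero]
    have : (0 : ℝ) ≤ max (Lp : ℝ) Lm := Lp.coe_nonneg.trans (le_max_left _ _)
    positivity

theorem CPTFunction.lipConst_nonneg (C : CPTFunction) (Lp Lm : ℝ≥0) (o : Fin k → ℝ) :
    0 ≤ C.lipConst Lp Lm o := by
  have h1 : 0 ≤ ⨆ i, |C.u (o i)| := Real.iSup_nonneg fun i => abs_nonneg _
  have h2 : (0 : ℝ) ≤ max (Lp : ℝ) Lm := Lp.coe_nonneg.trans (le_max_left _ _)
  unfold CPTFunction.lipConst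
  positivity

theorem CPTFunction.abs_cpt_sub_le (C : CPTFunction) {Lp Lm : ℝ≥0}
    (hLp : LipschitzOnWith Lp C.wPlus (Set.Icc 0 1))
    (hLm : LipschitzOnWith Lm C.wMinus (Set.Icc 0 1)) (o : Fin k → ℝ) {p q : Fin k → ℝ}
    (hp : p ∈ subprob k) (hq : q ∈ subprob k) :
    |C.cpt o p - C.cpt o q| ≤ C.lipConst Lp Lm o * l2dist p q := by
  set U : ℝ := ⨆ i, |C.u (o i)| with hU
  set L : ℝ := max (Lp : ℝ) Lm with hL
  have hU0 : 0 ≤ U := Real.iSup_nonneg fun i => abs_nonneg _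
  have hL0 : 0 ≤ L := Lp.coe_nonneg.trans (le_max_left _ _)
  have hd := l2dist_nonneg p q
  calc |C.cpt o p - C.cpt o q|
      = |∑ i, C.u (o i) * (C.decisionWeight o p i - C.decisionWeight o q i)| := by
        simp only [CPTFunction.cpt, mul_sub, Finset.sum_sub_distrib]
    _ ≤ ∑ _i : Fin k, U * (2 * (L * (k * l2dist p q))) := by
        refine (Finset.abs_sum_le_sum_abs _ _).trans (Finset.sum_le_sum fun i _ => ?_)
        rw [abs_mul]
        refine mul_le_mul (le_ciSup (f := fun i => |C.u (o i)|) (Set.finite_range _).bddAbove i) ?_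
          (abs_nonneg _) hU0
        refine (C.abs_decisionWeight_sub_le hLp hLm o hp hq i).trans ?_
        gcongr
        exact sum_abs_sub_le p q
    _ = U * L * (2 * (k : ℝ) ^ 2) * l2dist p q := by
        rw [Finset.sum_const, Finset.card_univ, Fintype.card_fin, nsmul_eq_mul]; ring
    -- The argument gives `2k²`; the additional `k` in the constant is slack.
    _ ≤ U * L * (2 * (k : ℝ) ^ 2 + k) * l2dist p q := by
        gcongr
        linarith [(Nat.cast_nonneg k : (0 : ℝ) ≤ k)]
    _ = C.lipConst Lp Lm o * l2dist p q := rfl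

/-! ### The grid -/

theorem gridSide_pos {L ε : ℝ} (hL : 0 ≤ L) (hε : 0 < ε) (hk : 0 < k) : 0 < gridSide L ε k := by
  unfold gridSide
  split_ifs with h
  · exact one_pos
  · have hL' := lt_of_le_of_ne hL (Ne.symm h)
    have : (0 : ℝ) < k := Nat.cast_pos.2 hk
    positivity

theorem exists_mem_gridCube {L ε : ℝ} (hL : 0 ≤ L) (hε : 0 < ε) (hk : 0 < k) {p : Fin k → ℝ}
    (hp : p ∈ Set.Icc 0 1) : ∃ j : Fin k → Fin (gridNum L ε k), p ∈ gridCube L ε j := by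
  have hs := gridSide_pos hL hε hk
  have hnum : 1 ≤ gridNum L ε k * gridSide L ε k := by
    rw [← div_le_iff₀ hs]; exact Nat.le_ceil _
  have h : ∀ i, ∃ m : Fin (gridNum L ε k), ((m : ℕ) : ℝ) * gridSide L ε k ≤ p i ∧
      p i ≤ (((m : ℕ) : ℝ) + 1) * gridSide L ε k := by
    intro i
    have h0 : 0 ≤ p i := hp.1 i
    have h1 : p i ≤ 1 := hp.2 i
    have hf1 : (⌊p i / gridSide L ε k⌋₊ : ℝ) * gridSide L ε k ≤ p i := by
      rw [← le_div_iff₀ hs]; exact Nat.floor_le (by positivity)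
    have hf2 : p i ≤ ((⌊p i / gridSide L ε k⌋₊ : ℝ) + 1) * gridSide L ε k := by
      rw [← div_le_iff₀ hs]; exact (Nat.lt_floor_add_one _).le
    by_cases hlt : ⌊p i / gridSide L ε k⌋₊ < gridNum L ε k
    · exact ⟨⟨_, hlt⟩, hf1, hf2⟩
    -- Here `p i = 1` is the right end of the last cube, and the floor is one too large.
    · have hpos : 0 < gridNum L ε k := Nat.ceil_pos.2 (by positivity)
      have hle : (gridNum L ε k : ℝ) ≤ ⌊p i / gridSide L ε k⌋₊ := by exact_mod_cast not_lt.1 hlt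
      have hcast : ((gridNum L ε k - 1 : ℕ) : ℝ) = gridNum L ε k - 1 := by
        rw [Nat.cast_sub hpos, Nat.cast_one]
      refine ⟨⟨gridNum L ε k - 1, by omega⟩, ?_, ?_⟩
      · refine le_trans ?_ hf1
        simp only [hcast]
        gcongr
        linarith
      · simp only [hcast]
        rw [sub_add_cancel]
        exact h1.trans hnum
  choose j hj using h
  exact ⟨j, hj⟩

theorem mul_l2dist_le_of_mem_gridCube {L ε : ℝ} (hL : 0 ≤ L) (hε : 0 < ε) (hk : 0 < k)
    {j : Fin k → Fin (gridNum L ε k)} {p q : Fin k → ℝ} (hp : p ∈ gridCube L ε j)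
    (hq : q ∈ gridCube L ε j) : L * l2dist p q ≤ ε := by
  rcases hL.eq_or_lt with h | hL'
  · rw [← h, zero_mul]; exact hε.le
  have hd : l2dist p q ≤ Real.sqrt k * gridSide L ε k :=
    l2dist_le_sqrt_mul (gridSide_pos hL hε hk).le fun i => by
      have h1 := hp i
      have h2 := hq i
      rw [abs_le]
      constructor <;> linarith [h1.1, h1.2, h2.1, h2.2]
  have hk' : (0 : ℝ) < Real.sqrt k := Real.sqrt_pos.2 (Nat.cast_pos.2 hk)
  calc L * l2dist p q ≤ L * (Real.sqrt k * gridSide L ε k) := mul_le_mul_of_nonneg_left hd hL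
    _ = ε := by
      rw [gridSide, if_neg hL'.ne']
      field_simp

theorem exists_isGridMax {L ε : ℝ} (hL : 0 ≤ L) (hε : 0 < ε) (hk : 0 < k) {P : Set (Fin k → ℝ)}
    (hP : P ⊆ Set.Icc 0 1) (hne : P.Nonempty) (f : (Fin k → ℝ) → ℝ) : ∃ v, IsGridMax L ε P f v := by
  classical
  let c : (Fin k → Fin (gridNum L ε k)) → (Fin k → ℝ) := fun j =>
    if h : (gridCube L ε j ∩ P).Nonempty then h.some else 0
  obtain ⟨p, hp⟩ := hne
  obtain ⟨j₀, hj₀⟩ := exists_mem_gridCube hL hε hk (hP hp)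
  obtain ⟨j, hj, hmax⟩ := Set.exists_max_image {j | (gridCube L ε j ∩ P).Nonempty} (fun j => f (c j))
    (Set.toFinite _) ⟨j₀, p, hj₀, hp⟩
  refine ⟨f (c j), c, fun j hj => ?_, ⟨j, hj, rfl⟩, ?_⟩
  · rw [show c j = hj.some from dif_pos hj]; exact hj.some_mem
  · rintro _ ⟨i, hi, rfl⟩
    exact hmax i hi

end Analysis

/-! ### Feasibility of the algorithm and the two error bounds. -/

section Algorithm

variable {S : Type*} {A : Type*} [Finite S] [Finite A] {M : MDP S A} {Φ : WRObjective S}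

theorem WRObjective.numOutc_pos (Φ : WRObjective S) : 0 < Φ.numOutc := by
  obtain ⟨i, -⟩ := Φ.exists_outcomes_eq_zero
  exact i.pos

theorem outcomeVec_mem_subprob (σ : Strategy M) : outcomeVec Φ σ ∈ subprob Φ.numOutc :=
  ⟨outcomeVec_nonneg Φ σ, (sum_outcomeVec Φ σ).le⟩

theorem queryVec_mem_subprob (hΦ : Φ.Absorbing M) (hr : Φ.NonzeroRewards)
    (τ : Strategy (makeStopping M Φ)) : queryVec M Φ τ ∈ subprob Φ.numOutc :=
  ⟨queryVec_nonneg τ, (sum_queryVec hΦ hr τ).le⟩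

theorem hull_subset_subprob (hΦ : Φ.Absorbing M) (hr : Φ.NonzeroRewards) {ε : ℝ}
    {E : Finset (Fin Φ.numOutc → ℝ)}
    (hE : IsFrontierApprox (makeStopping M Φ) (query (liftObjective M Φ) none Φ.outcomes) ε E) :
    hull E ⊆ subprob Φ.numOutc := by
  refine convexHull_min (fun p hp => ⟨hE.nonneg p hp, ?_⟩) convex_subprob
  obtain ⟨τ, hτ⟩ := hE.achievable p hp
  exact (Finset.sum_le_sum fun i _ => hτ i).trans (sum_queryVec hΦ hr τ).le

/-- The frontier is a subset of the compact unit cube, so it has a finite net of its own points; by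
convexity the hull of the net stays in the frontier. -/
theorem exists_isFrontierApprox (hΦ : Φ.Absorbing M) (hr : Φ.NonzeroRewards) {ε : ℝ} (hε : 0 < ε) :
    ∃ E, IsFrontierApprox (makeStopping M Φ) (query (liftObjective M Φ) none Φ.outcomes) ε E := by
  have hsub : Set.range (queryVec M Φ) ⊆ Set.Icc 0 1 := by
    rintro _ ⟨τ, rfl⟩
    exact subprob_subset_Icc (queryVec_mem_subprob hΦ hr τ)
  have hc : 0 < Real.sqrt Φ.numOutc + 1 := by positivity
  obtain ⟨t, htR, htfin, hcover⟩ := (isCompact_Icc.totallyBounded.subset hsub).exists_subset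
    (Metric.dist_mem_uniformity (by positivity : 0 < ε / (Real.sqrt Φ.numOutc + 1)))
  have hhull : hull htfin.toFinset ⊆ Set.range (queryVec M Φ) :=
    convexHull_min (by simpa using htR) (convex_range_queryVec hΦ)
  refine ⟨htfin.toFinset, ?_, ?_, ?_, ?_⟩
  · intro p hp
    exact (hsub (htR (htfin.mem_toFinset.1 hp))).1
  · intro p hp
    obtain ⟨τ, rfl⟩ := htR (htfin.mem_toFinset.1 hp)
    exact ⟨τ, fun i => le_rfl⟩
  · intro p hp
    refine ⟨p, ?_, (l2dist_self p).trans_le hε.le⟩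
    rw [paretoFrontier_eq hΦ hr]
    exact hhull hp
  · intro q hq
    rw [paretoFrontier_eq hΦ hr] at hq
    obtain ⟨p, hp, hqp⟩ := Set.mem_iUnion₂.1 (hcover hq)
    refine ⟨p, subset_convexHull ℝ _ (htfin.mem_toFinset.2 hp), ?_⟩
    rw [l2dist_comm]
    have hqp : dist q p < ε / (Real.sqrt Φ.numOutc + 1) := hqp
    refine (l2dist_le_sqrt_mul (by positivity : 0 ≤ ε / (Real.sqrt Φ.numOutc + 1))
      fun i => (dist_le_pi_dist q p i).trans hqp.le).trans ?_
    rw [mul_div_assoc', div_le_iff₀ hc]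
    nlinarith [Real.sqrt_nonneg (Φ.numOutc : ℝ)]

/-- Outcome vectors lie in a bounded set on which the CPT-function is Lipschitz; they are compared
with the zero vector. -/
theorem bddAbove_strategyValue (C : CPTFunction) {Lp Lm : ℝ≥0}
    (hLp : LipschitzOnWith Lp C.wPlus (Set.Icc 0 1))
    (hLm : LipschitzOnWith Lm C.wMinus (Set.Icc 0 1)) :
    BddAbove (Set.range fun σ : Strategy M => strategyValue Φ C σ) := by
  have h0 : (0 : Fin Φ.numOutc → ℝ) ∈ subprob Φ.numOutc := ⟨le_rfl, by simp⟩
  refine ⟨C.cpt Φ.outcomes 0 + C.lipConst Lp Lm Φ.outcomes * (Real.sqrt Φ.numOutc * 1), ?_⟩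
  rintro _ ⟨σ, rfl⟩
  have hσ := outcomeVec_mem_subprob (Φ := Φ) σ
  have h1 := (abs_le.1 (C.abs_cpt_sub_le hLp hLm Φ.outcomes hσ h0)).2
  have h2 : l2dist (outcomeVec Φ σ) 0 ≤ Real.sqrt Φ.numOutc * 1 :=
    l2dist_le_sqrt_mul zero_le_one fun i => by
      rw [Pi.zero_apply, sub_zero, abs_of_nonneg (outcomeVec_nonneg Φ σ i)]
      exact (subprob_subset_Icc hσ).2 i
  have h3 := mul_le_mul_of_nonneg_left h2 (C.lipConst_nonneg Lp Lm Φ.outcomes)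
  simp only [strategyValue_eq_cpt]
  linarith

theorem le_add_of_forall_mul {x y L : ℝ} (hL : 0 ≤ L) (h : ∀ η > 0, x ≤ y + L * η) : x ≤ y := by
  refine le_of_forall_pos_le_add fun δ hδ => (h (δ / (L + 1)) (by positivity)).trans ?_
  have : L * (δ / (L + 1)) ≤ δ := by
    rw [mul_div_assoc', div_le_iff₀ (by positivity)]
    nlinarith
  linarith

/-- Chain of four points: an outcome vector, a query vector within `η`, a hull point within `ε`, and
the vector selected in its cube. The costs are `L * η`, `L * ε` and `ε`, with `η` arbitrary. -/
theorem cptVal_le_add (hΦ : Φ.Absorbing M) (hr : Φ.NonzeroRewards) (C : CPTFunction) {Lp Lm : ℝ≥0}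
    (hLp : LipschitzOnWith Lp C.wPlus (Set.Icc 0 1))
    (hLm : LipschitzOnWith Lm C.wMinus (Set.Icc 0 1)) {ε : ℝ} (hε : 0 < ε) {v : ℝ}
    (hv : AlgorithmOutput M Φ C Lp Lm ε v) :
    cptVal M Φ C ≤ v + ε * (1 + C.lipConst Lp Lm Φ.outcomes) := by
  obtain ⟨E, hE, c, hc, -, hmax⟩ := hv
  have hL := C.lipConst_nonneg Lp Lm Φ.outcomes
  have hlip := fun {p q} hp hq => (abs_le.1 (C.abs_cpt_sub_le hLp hLm Φ.outcomes (p := p) (q := q) hp hq)).2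
  refine ciSup_le fun σ => le_add_of_forall_mul hL fun η hη => ?_
  obtain ⟨_, ⟨τ, rfl⟩, hx⟩ := exists_l2dist_le_of_mem_closure (outcomeVec_mem_closure hΦ hr σ) hη
  obtain ⟨p, hp, hpq⟩ := hE.cover (queryVec M Φ τ) (by rw [paretoFrontier_eq hΦ hr]; exact ⟨τ, rfl⟩)
  have hhull := hull_subset_subprob hΦ hr hE
  obtain ⟨j, hj⟩ := exists_mem_gridCube hL hε Φ.numOutc_pos (subprob_subset_Icc (hhull hp))
  have hcj := hc j ⟨p, hj, hp⟩
  have h1 := hlip (outcomeVec_mem_subprob σ) (queryVec_mem_subprob hΦ hr τ)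
  have h2 := hlip (queryVec_mem_subprob hΦ hr τ) (hhull hp)
  have h3 := hlip (hhull hp) (hhull hcj.2)
  have h4 := mul_l2dist_le_of_mem_gridCube hL hε Φ.numOutc_pos hj hcj.1
  have h5 : C.cpt Φ.outcomes (c j) ≤ v := hmax ⟨j, ⟨p, hj, hp⟩, rfl⟩
  have h6 := mul_le_mul_of_nonneg_left hx hL
  have h7 := mul_le_mul_of_nonneg_left hpq hL
  rw [l2dist_comm] at h7
  rw [strategyValue_eq_cpt]
  linarith

/-- Grid selection costs nothing in this direction: `v` is already the value at a hull point, which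
is within `ε` of a query vector and thus nearly within `ε` of an outcome vector. -/
theorem le_cptVal_add (hΦ : Φ.Absorbing M) (hr : Φ.NonzeroRewards) (C : CPTFunction) {Lp Lm : ℝ≥0}
    (hLp : LipschitzOnWith Lp C.wPlus (Set.Icc 0 1))
    (hLm : LipschitzOnWith Lm C.wMinus (Set.Icc 0 1)) {ε : ℝ} {v : ℝ}
    (hv : AlgorithmOutput M Φ C Lp Lm ε v) :
    v ≤ cptVal M Φ C + C.lipConst Lp Lm Φ.outcomes * ε := by
  obtain ⟨E, hE, c, hc, ⟨j, hj, rfl⟩, -⟩ := hv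
  have hL := C.lipConst_nonneg Lp Lm Φ.outcomes
  have hlip := fun {p q} hp hq => (abs_le.1 (C.abs_cpt_sub_le hLp hLm Φ.outcomes (p := p) (q := q) hp hq)).2
  refine le_add_of_forall_mul hL fun η hη => ?_
  have hcj := (hc j hj).2
  obtain ⟨q, hq, hpq⟩ := hE.close _ hcj
  rw [paretoFrontier_eq hΦ hr] at hq
  obtain ⟨τ, rfl⟩ := hq
  obtain ⟨_, ⟨σ, rfl⟩, hx⟩ := exists_l2dist_le_of_mem_closure (queryVec_mem_closure hΦ hr τ) hη
  have h1 := hlip (hull_subset_subprob hΦ hr hE hcj) (queryVec_mem_subprob hΦ hr τ)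
  have h2 := hlip (queryVec_mem_subprob hΦ hr τ) (outcomeVec_mem_subprob σ)
  have h3 := le_ciSup (bddAbove_strategyValue (M := M) (Φ := Φ) C hLp hLm) σ
  have h4 := mul_le_mul_of_nonneg_left hx hL
  have h5 := mul_le_mul_of_nonneg_left hpq hL
  have h6 : C.cpt Φ.outcomes (outcomeVec Φ σ) ≤ cptVal M Φ C := by
    rw [← strategyValue_eq_cpt]; exact h3
  linarith

theorem exists_algorithmOutput (hΦ : Φ.Absorbing M) (hr : Φ.NonzeroRewards) (C : CPTFunction)
    (Lp Lm : ℝ≥0) {ε : ℝ} (hε : 0 < ε) : ∃ v, AlgorithmOutput M Φ C Lp Lm ε v := by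
  obtain ⟨E, hE⟩ := exists_isFrontierApprox (M := M) hΦ hr hε
  have hne : (hull E).Nonempty := by
    obtain ⟨τ⟩ := (inferInstance : Nonempty (Strategy (makeStopping M Φ)))
    obtain ⟨p, hp, -⟩ := hE.cover (queryVec M Φ τ) (by rw [paretoFrontier_eq hΦ hr]; exact ⟨τ, rfl⟩)
    exact ⟨p, hp⟩
  obtain ⟨v, hv⟩ := exists_isGridMax (C.lipConst_nonneg Lp Lm Φ.outcomes) hε Φ.numOutc_pos
    ((hull_subset_subprob hΦ hr hE).trans subprob_subset_Icc) hne (C.cpt Φ.outcomes)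
  exact ⟨v, E, hE, hv⟩

end Algorithm
end CPTMDP

theorem mainTheorem10 {S : Type*} {A : Type*} [Finite S] [Finite A] (M : CPTMDP.MDP S A)
    (Φ : CPTMDP.WRObjective S) (hΦ : Φ.Absorbing M) (hr : Φ.NonzeroRewards)
    (C : CPTMDP.CPTFunction) (Lp Lm : ℝ≥0)
    (hLp : LipschitzOnWith Lp C.wPlus (Set.Icc 0 1))
    (hLm : LipschitzOnWith Lm C.wMinus (Set.Icc 0 1))
    (ε : ℝ) (hε : 0 < ε) :
    IsLUB (Set.range fun σ : CPTMDP.Strategy M => CPTMDP.strategyValue Φ C σ)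
      (CPTMDP.cptVal M Φ C) ∧
    (∃ v, CPTMDP.AlgorithmOutput M Φ C Lp Lm ε v) ∧
    ∀ v, CPTMDP.AlgorithmOutput M Φ C Lp Lm ε v →
      |CPTMDP.cptVal M Φ C - v| ≤ ε * (1 + C.lipConst Lp Lm Φ.outcomes) := by
  refine ⟨isLUB_ciSup (CPTMDP.bddAbove_strategyValue C hLp hLm),
    CPTMDP.exists_algorithmOutput hΦ hr C Lp Lm hε, fun v hv => abs_le.2 ⟨?_, ?_⟩⟩
  · linarith [CPTMDP.le_cptVal_add hΦ hr C hLp hLm hv]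
  · linarith [CPTMDP.cptVal_le_add hΦ hr C hLp hLm hε hv]
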